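/- **Setting.** Let $N\ge 1$, $p\ge 0$, $\lambda,w\in\mathbb C$, and let $\varrho$ be a representation of $gl(N)$ on a finite-dimensional space of dimension $\dim\varrho\ge 1$ with basis labelled by $\alpha$. Upper signs refer to bosonic, lower signs to fermionic matter fields. Consider fields on the circle $q^\mu(t),p_\mu(t)$ ($0\le\mu<N$; bosonic) and $\phi_{\alpha,\mathbf m}(t),\pi^{\alpha,\mathbf m}(t)$ ($\mathbf m\in\mathbb N^N$, $|\mathbf m|\le p$; all bosonic or all fermionic), with Fourier modes $a(t)=\sum_{n\in\mathbb Z}\hat a(n)e^{-int}$ and only non-zero graded commutators $[p_\mu(s),q^\nu(t)]=\delta_\mu^\nu\delta(s-t)$ and $[\pi^{\alpha,\mathbf m}(s),\phi_{\beta,\mathbf n}(t)]=\delta^\alpha_\beta\delta^{\mathbf m}_{\mathbf n}\delta(s-t)$. The Fock module is the quotient of the enveloping algebra of the modes by the left ideal generated by $\hat q^\mu(n),\hat\phi_{\alpha,\mathbf m}(n)$ with $n<0$ and $\hat p_\mu(n),\hat\pi^{\alpha,\mathbf m}(n)$ with $n\le 0$; the class of $1$ is the vacuum $|0\rangle$.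 Normal ordering is ${:}fp{:}=f\,p_{\le}+p_{>}f$ and ${:}\pi\phi{:}=\pi_>\phi\pm\phi\,\pi_\le$, where $>$ and $\le$ denote the parts of positive and of non-positive frequency. The algebra $DRO(N)$ acts on the Fock module by the modes of the polynomials in $q^\mu(t)$ and its derivatives, by $$\mathcal L_\xi=\int dt\,\Big({:}\xi^\mu(q(t))p_\mu(t){:}\ \mp\sum_{|\mathbf m|\le|\mathbf n|\le p}{:}\pi^{,\mathbf n}(t)\,T^{\mathbf m}_{\mathbf n}(\xi(q(t)))\,\phi_{,\mathbf m}(t){:}\Big)$$ for polynomial vector fields $\xi$, where $$T^{\mathbf m}_{\mathbf n}(\xi)=\binom{\mathbf n}{\mathbf m}\partial_{\mathbf n-\mathbf m+\underline\nu}\xi^\mu\varrho(T^\nu_\mu)+\binom{\mathbf n}{\mathbf m-\underline\mu}(1-\delta^{\mathbf m-\underline\mu}_{\mathbf n})\partial_{\mathbf n-\mathbf m+\underline\mu}\xi^\mu$$ (summed over $\mu,\nu$, with $T^\nu_\mu$ the matrix units of $gl(N)$ and $\underline\mu$ the unit multi-index in direction $\mu$), and by the modes of $$L(t)=-{:}\dot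 q^\mu p_\mu{:}\pm\sum_{|\mathbf m|\le p}\Big\{-{:}\pi^{,\mathbf m}\dot\phi_{,\mathbf m}{:}+\lambda\,{:}\tfrac{d}{dt}(\pi^{,\mathbf m}\phi_{,\mathbf m}){:}+iw\,{:}\pi^{,\mathbf m}\phi_{,\mathbf m}{:}\Big\}\pm\binom{N+p}{p}\dim\varrho\,\frac{\lambda-\lambda^2-w+w^2}{4\pi i}.$$ The Hamiltonian is $H=-i\int dt\,L(t)$; a vector $v$ has energy $E$ if $Hv=Ev$. A *cyclic state* is a non-zero vector annihilated by all modes of negative frequency of $L(t)$. *Submodule* means a subspace invariant under all the operators of $DRO(N)$ above. **Theorem.** (1) The vacuum is a cyclic state; its energy, the lowest energy of the module, is $$h=\mp\tfrac12\binom{N+p}{p}\dim\varrho\,\big((w-\tfrac12)^2-(\lambda-\tfrac12)^2\big),$$ and $A|0\rangle=0$ for every $A$ in the associative algebra generated by the operators of $DRO(N)$ such that $[H,A]=-w_AA$ with a real $w_A>0$. The module is reducible. (2) For a scalar bosonic zero-jet ($p=0$, $\dim\varrho=1$) the states $|n\rangle=\hat\phi(0)^n|0\rangle$, $n\ge0$,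 are cyclic, with energy $h+nw$. (3) For fermionic $p$-jets and $0\le\ell\le p$ put $\hat\Xi_\ell(n)=\prod_\alpha\prod_{|\mathbf m|\le\ell}\hat\phi_{\alpha,\mathbf m}(n)$ (in any order). For $k\ge0$ the states $|k,\ell\rangle=\hat\Xi_\ell(k-1)\cdots\hat\Xi_\ell(0)|0\rangle$ are cyclic, with energy $$h+\tfrac12\binom{N+\ell}{\ell}\dim\varrho\,\big(k^2+(2w-1)k\big).$$ (4) For fermionic $p$-jets and $0\le\ell\le p$ put $\hat\Xi_{-\ell-1}(n)=\prod_\alpha\prod_{\ell\le|\mathbf m|\le p}\hat\pi^{\alpha,\mathbf m}(n)$ (in any order). For $k\ge0$ the states $|k,-\ell-1\rangle=\hat\Xi_{-\ell-1}(k)\cdots\hat\Xi_{-\ell-1}(1)|0\rangle$ are cyclic, with energy $$h+\tfrac12\Big\{\binom{N+p}{p}-\binom{N+\ell-1}{\ell-1}\Big\}\dim\varrho\,\big(k^2-(2w-1)k\big),$$ where $\binom{N-1}{-1}=0$. (The product $\hat\Xi_{-\ell-1}(k-1)\cdots\hat\Xi_{-\ell-1}(0)|0\rangle$, $k\ge1$,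 is the zero vector.) (5) Each of the states in (2) with $n\ge1$ and in (3), (4) with $k\ge1$ generates a submodule that does not contain $|0\rangle$, and does not itself lie in the submodule generated by $|0\rangle$. So each of these additional cyclic states exhibits the reducibility of the module. -/

import Mathlib

namespace DRO

open scoped Classical in
/-- The sum of a family of operators that is locally finite (each vector is killed by all but
finitely many members of the family). Local finiteness of the families used below is proved. -/
noncomputable def lsum {I F : Type*} [AddCommGroup F] [Module ℂ F]
    (T : I → Module.End ℂ F) : Module.End ℂ F :=
  if h : ∀ v, (Function.support fun i => T i v).Finite then
    { toFun := fun v => ∑ᶠ i, T i v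
      map_add' := fun u v => by
        simp only [map_add]
        exact finsum_add_distrib (h u) (h v)
      map_smul' := fun c v => by
        simp only [map_smul, RingHom.id_apply]
        exact (smul_finsum' c (h v)).symm }
  else 0

section Fields

variable {F : Type*} [AddCommGroup F] [Module ℂ F]

/-- A family of operators is locally finite. -/
def LocFin {I : Type*} (T : I → Module.End ℂ F) : Prop :=
  ∀ v, (Function.support fun i => T i v).Finite

theorem lsum_apply {I : Type*} {T : I → Module.End ℂ F} (h : LocFin T) (v : F) :
    lsum T v = ∑ᶠ i, T i v := by
  unfold lsum
  unfold LocFin at h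
  rw [dif_pos h]
  rfl

/-- A periodic operator-valued function `a(t) = ∑ₙ aₙ e^{-int}`, given by its Fourier modes, is a
field if every vector is killed by the modes of sufficiently negative frequency. -/
def IsField (a : ℤ → Module.End ℂ F) : Prop :=
  ∀ v, ∃ K : ℤ, ∀ n < K, a n v = 0

/-- The modes of the time derivative. -/
noncomputable def tderiv (a : ℤ → Module.End ℂ F) : ℤ → Module.End ℂ F :=
  fun n => (-Complex.I * (n : ℂ)) • a n

/-- The modes of the constant function `1`. -/
noncomputable def fone : ℤ → Module.End ℂ F :=
  fun n => if n = 0 then 1 else 0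

/-- The modes of the product `a(t) b(t)` of commuting fields. -/
noncomputable def fmul (a b : ℤ → Module.End ℂ F) : ℤ → Module.End ℂ F :=
  fun m => lsum fun j : ℤ => a (m - j) * b j

/-- The modes of the normal ordered product `P_>(t) Φ(t) + σ Φ(t) P_≤(t)`. -/
noncomputable def normOrd (σ : ℂ) (P Φ : ℤ → Module.End ℂ F) : ℤ → Module.End ℂ F :=
  fun m => lsum fun j : ℤ => if 0 < j then P j * Φ (m - j) else σ • (Φ (m - j) * P j)

/-- All modes of `a` commute with all modes of `b`. -/
def FieldsCommute (a b : ℤ → Module.End ℂ F) : Prop :=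
  ∀ m n, Commute (a m) (b n)

theorem commute_lsum {I : Type*} {T : I → Module.End ℂ F} (h : LocFin T)
    {X : Module.End ℂ F} (hX : ∀ i, Commute X (T i)) : Commute X (lsum T) := by
  ext v
  change X (lsum T v) = lsum T (X v)
  rw [lsum_apply h, lsum_apply h]
  rw [map_finsum X (h v)]
  refine finsum_congr fun i => ?_
  exact congrArg (fun f : Module.End ℂ F => f v) (hX i).eq

theorem IsField.tderiv {a : ℤ → Module.End ℂ F} (ha : IsField a) : IsField (tderiv a) := by
  intro v
  obtain ⟨K, hK⟩ := ha v
  exact ⟨K, fun n hn => by simp [DRO.tderiv, hK n hn]⟩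

theorem isField_fone : IsField (fone (F := F)) := fun v =>
  ⟨0, fun n hn => by simp [fone, hn.ne]⟩

theorem IsField.smul {a : ℤ → Module.End ℂ F} (ha : IsField a) (c : ℂ) :
    IsField fun n => c • a n := by
  intro v
  obtain ⟨K, hK⟩ := ha v
  exact ⟨K, fun n hn => by simp [hK n hn]⟩

theorem isField_sum {I : Type*} (S : Finset I) {a : I → ℤ → Module.End ℂ F}
    (ha : ∀ i, IsField (a i)) : IsField fun n => ∑ i ∈ S, a i n := by
  intro v
  choose K hK using fun i => ha i v
  obtain ⟨B, hB⟩ := (S.image K).bddBelow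
  refine ⟨B, fun n hn => ?_⟩
  rw [LinearMap.sum_apply]
  refine Finset.sum_eq_zero fun i hi => hK i n (lt_of_lt_of_le hn (hB ?_))
  exact Finset.mem_coe.2 (Finset.mem_image_of_mem K hi)

theorem locFin_fmul {a b : ℤ → Module.End ℂ F} (ha : IsField a) (hb : IsField b)
    (hab : FieldsCommute a b) (m : ℤ) : LocFin fun j : ℤ => a (m - j) * b j := by
  intro v
  obtain ⟨K, hK⟩ := ha v
  obtain ⟨L, hL⟩ := hb v
  refine (Set.finite_Icc L (m - K)).subset fun j hj => ?_
  rw [Function.mem_support] at hj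
  refine ⟨?_, ?_⟩
  · by_contra hlt
    exact hj (by simp [hL j (not_le.1 hlt)])
  · by_contra hlt
    refine hj ?_
    simp only [(hab (m - j) j).eq]
    simp [hK (m - j) (by omega)]

theorem IsField.fmul {a b : ℤ → Module.End ℂ F} (ha : IsField a) (hb : IsField b)
    (hab : FieldsCommute a b) : IsField (fmul a b) := by
  intro v
  obtain ⟨K, hK⟩ := ha v
  obtain ⟨L, hL⟩ := hb v
  refine ⟨K + L, fun m hm => ?_⟩
  unfold DRO.fmul
  rw [lsum_apply (locFin_fmul ha hb hab m)]
  refine finsum_eq_zero_of_forall_eq_zero fun j => ?_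
  by_cases h : j < L
  · simp [hL j h]
  · rw [(hab (m - j) j).eq]
    simp [hK (m - j) (by omega)]

theorem FieldsCommute.fmul_right {a b c : ℤ → Module.End ℂ F} (hb : IsField b) (hc : IsField c)
    (hbc : FieldsCommute b c) (hab : FieldsCommute a b) (hac : FieldsCommute a c) :
    FieldsCommute a (fmul b c) := fun m n =>
  commute_lsum (locFin_fmul hb hc hbc n) fun j => (hab m (n - j)).mul_right (hac m j)

theorem locFin_normOrd (σ : ℂ) {P Φ : ℤ → Module.End ℂ F} (hP : IsField P) (hΦ : IsField Φ)
    (m : ℤ) : LocFin fun j : ℤ =>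
      if 0 < j then P j * Φ (m - j) else σ • (Φ (m - j) * P j) := by
  intro v
  obtain ⟨K, hK⟩ := hP v
  obtain ⟨L, hL⟩ := hΦ v
  refine (Set.finite_Icc (min K 0) (max 0 (m - L))).subset fun j hj => ?_
  rw [Function.mem_support] at hj
  by_cases h : 0 < j
  · refine ⟨by omega, ?_⟩
    by_contra hlt
    refine hj ?_
    simp only [if_pos h]
    simp [hL (m - j) (by omega)]
  · refine ⟨?_, by omega⟩
    by_contra hlt
    refine hj ?_
    simp only [if_neg h]
    simp [hK j (by omega)]

theorem IsField.normOrd (σ : ℂ) {P Φ : ℤ → Module.End ℂ F} (hP : IsField P) (hΦ : IsField Φ) :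
    IsField (normOrd σ P Φ) := by
  intro v
  obtain ⟨K, hK⟩ := hP v
  obtain ⟨L, hL⟩ := hΦ v
  choose B hB using fun j : ℤ => hΦ (P j v)
  obtain ⟨M, hM⟩ := ((Finset.Icc K 0).image fun j => B j + j).bddBelow
  refine ⟨min L M, fun m hm => ?_⟩
  unfold DRO.normOrd
  rw [lsum_apply (locFin_normOrd σ hP hΦ m)]
  refine finsum_eq_zero_of_forall_eq_zero fun j => ?_
  by_cases h : 0 < j
  · rw [if_pos h]
    simp [hL (m - j) (by omega)]
  · rw [if_neg h]
    by_cases hj : j < K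
    · simp [hK j hj]
    · have hmem : B j + j ∈ (Finset.Icc K 0).image fun j => B j + j :=
        Finset.mem_image_of_mem (fun j => B j + j) (Finset.mem_Icc.2 ⟨by omega, by omega⟩)
      have := hM (Finset.mem_coe.2 hmem)
      simp [hB j (m - j) (by omega)]

theorem FieldsCommute.normOrd_right (σ : ℂ) {a P Φ : ℤ → Module.End ℂ F} (hP : IsField P)
    (hΦ : IsField Φ) (haP : FieldsCommute a P) (haΦ : FieldsCommute a Φ) :
    FieldsCommute a (normOrd σ P Φ) := fun m n =>
  commute_lsum (locFin_normOrd σ hP hΦ n) fun j => by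
    by_cases h : 0 < j
    · simp only [if_pos h]
      exact (haP m j).mul_right (haΦ m (n - j))
    · simp only [if_neg h]
      exact ((haΦ m (n - j)).mul_right (haP m j)).smul_right σ

end Fields

/-- The statistics of the matter fields. -/
inductive Stat
  | boson
  | fermion

/-- The upper sign (bosons) or the lower sign (fermions) of `±`. -/
def Stat.sign : Stat → ℂ
  | .boson => 1
  | .fermion => -1

/-- The multi-indices `m = (m_0, …, m_{N-1})` of length `|m| ≤ p`. -/
abbrev JetIdx (N p : ℕ) : Type :=
  {m : Fin N → Fin (p + 1) // ∑ μ, (m μ : ℕ) ≤ p}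

/-- The multi-index as a tuple of natural numbers. -/
def JetIdx.exps {N p : ℕ} (m : JetIdx N p) : Fin N → ℕ := fun μ => (m.1 μ : ℕ)

/-- The length `|m|`. -/
def JetIdx.order {N p : ℕ} (m : JetIdx N p) : ℕ := ∑ μ, m.exps μ

/-- The pairs `(α, m)` that label the jet components `φ_{α,m}`. -/
abbrev Comp (N p : ℕ) (ι : Type*) : Type _ := ι × JetIdx N p

/-- The phase space modes `q̂^μ(n)`, `p̂_μ(n)`, `φ̂_{α,m}(n)`, `π̂^{α,m}(n)`. -/
inductive Mode (N p : ℕ) (ι : Type*)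
  | q (μ : Fin N) (n : ℤ)
  | p (μ : Fin N) (n : ℤ)
  | phi (A : Comp N p ι) (n : ℤ)
  | mom (A : Comp N p ι) (n : ℤ)

/-- The frequency of a mode. -/
def Mode.freq {N p : ℕ} {ι : Type*} : Mode N p ι → ℤ
  | .q _ n => n
  | .p _ n => n
  | .phi _ n => n
  | .mom _ n => n

/-- Whether a mode is one of the matter modes `φ̂`, `π̂`. -/
def Mode.isMatter {N p : ℕ} {ι : Type*} : Mode N p ι → Bool
  | .q _ _ => false
  | .p _ _ => false
  | .phi _ _ => true
  | .mom _ _ => true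

/-- The modes that annihilate the vacuum: those of `q_<`, `p_≤`, `φ_<`, `π_≤`. -/
def Mode.Annihilates {N p : ℕ} {ι : Type*} : Mode N p ι → Prop
  | .q _ n => n < 0
  | .p _ n => n ≤ 0
  | .phi _ n => n < 0
  | .mom _ n => n ≤ 0

/-- The sign of the graded exchange of two modes. -/
def exch (s : Stat) {N p : ℕ} {ι : Type*} (x y : Mode N p ι) : ℂ :=
  if x.isMatter && y.isMatter then s.sign else 1

section Heisenberg

variable {N p : ℕ} {ι : Type*} [DecidableEq ι]

/-- The graded bracket of two modes: the Fourier components of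
`[p_μ(s), q^ν(t)] = δ_μ^ν δ(s-t)` and `[π^A(s), φ_B(t)] = δ^A_B δ(s-t)`,
with `δ(t) = (1/2π) ∑ₙ e^{-int}`. -/
noncomputable def pairing (s : Stat) : Mode N p ι → Mode N p ι → ℂ
  | .p μ m, .q ν n => if μ = ν ∧ m + n = 0 then 1 / (2 * (Real.pi : ℂ)) else 0
  | .q ν n, .p μ m => if μ = ν ∧ m + n = 0 then -(1 / (2 * (Real.pi : ℂ))) else 0
  | .mom A m, .phi B n => if A = B ∧ m + n = 0 then 1 / (2 * (Real.pi : ℂ)) else 0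
  | .phi B n, .mom A m => if A = B ∧ m + n = 0 then -s.sign * (1 / (2 * (Real.pi : ℂ))) else 0
  | _, _ => 0

/-- The graded commutation relations `x y - (±) y x = [x, y]`. -/
inductive HeisRel (s : Stat) :
    FreeAlgebra ℂ (Mode N p ι) → FreeAlgebra ℂ (Mode N p ι) → Prop
  | comm (x y : Mode N p ι) : HeisRel s
      (FreeAlgebra.ι ℂ x * FreeAlgebra.ι ℂ y)
      (exch s x y • (FreeAlgebra.ι ℂ y * FreeAlgebra.ι ℂ x) +
        algebraMap ℂ (FreeAlgebra ℂ (Mode N p ι)) (pairing s x y))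

end Heisenberg

/-- The enveloping algebra of the graded Heisenberg algebra of the modes. -/
def Heis (s : Stat) (N p : ℕ) (ι : Type*) [DecidableEq ι] : Type _ :=
  RingQuot (HeisRel (N := N) (p := p) (ι := ι) s)

noncomputable instance (s : Stat) (N p : ℕ) (ι : Type*) [DecidableEq ι] : Ring (Heis s N p ι) :=
  inferInstanceAs (Ring (RingQuot (HeisRel (N := N) (p := p) (ι := ι) s)))

noncomputable instance (s : Stat) (N p : ℕ) (ι : Type*) [DecidableEq ι] :
    Algebra ℂ (Heis s N p ι) :=
  inferInstanceAs (Algebra ℂ (RingQuot (HeisRel (N := N) (p := p) (ι := ι) s)))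

/-- The quotient map onto the enveloping algebra. -/
noncomputable def heisMk (s : Stat) (N p : ℕ) (ι : Type*) [DecidableEq ι] :
    FreeAlgebra ℂ (Mode N p ι) →ₐ[ℂ] Heis s N p ι :=
  RingQuot.mkAlgHom ℂ (HeisRel (N := N) (p := p) (ι := ι) s)

/-- A mode as an element of the enveloping algebra. -/
noncomputable def gen (s : Stat) {N p : ℕ} {ι : Type*} [DecidableEq ι] (x : Mode N p ι) :
    Heis s N p ι :=
  heisMk s N p ι (FreeAlgebra.ι ℂ x)

/-- The left ideal generated by the modes that annihilate the vacuum. -/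
noncomputable def vacIdeal (s : Stat) (N p : ℕ) (ι : Type*) [DecidableEq ι] :
    Submodule (Heis s N p ι) (Heis s N p ι) :=
  Submodule.span (Heis s N p ι) {a | ∃ x : Mode N p ι, x.Annihilates ∧ a = gen s x}

/-- The Fock space: the enveloping algebra modulo the relations `x|0⟩ = 0`, `x` annihilating. -/
def Fock (s : Stat) (N p : ℕ) (ι : Type*) [DecidableEq ι] : Type _ :=
  Heis s N p ι ⧸ vacIdeal s N p ι

section FockSpace

variable (s : Stat) {N p : ℕ} {ι : Type*} [DecidableEq ι]

noncomputable instance : AddCommGroup (Fock s N p ι) :=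
  inferInstanceAs (AddCommGroup (Heis s N p ι ⧸ vacIdeal s N p ι))

noncomputable instance : Module (Heis s N p ι) (Fock s N p ι) :=
  inferInstanceAs (Module (Heis s N p ι) (Heis s N p ι ⧸ vacIdeal s N p ι))

noncomputable instance : Module ℂ (Fock s N p ι) :=
  inferInstanceAs (Module ℂ (Heis s N p ι ⧸ vacIdeal s N p ι))

instance : IsScalarTower ℂ (Heis s N p ι) (Fock s N p ι) :=
  inferInstanceAs (IsScalarTower ℂ (Heis s N p ι) (Heis s N p ι ⧸ vacIdeal s N p ι))

/-- The vacuum `|0⟩`. -/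
noncomputable def vac : Fock s N p ι :=
  (Submodule.Quotient.mk (1 : Heis s N p ι) : Heis s N p ι ⧸ vacIdeal s N p ι)

/-- A mode as an operator on Fock space. -/
noncomputable def op (x : Mode N p ι) : Module.End ℂ (Fock s N p ι) :=
  Algebra.lsmul ℂ ℂ (Fock s N p ι) (gen s x)

/-- The field `q^μ(t)`. -/
noncomputable def qF (μ : Fin N) : ℤ → Module.End ℂ (Fock s N p ι) := fun n => op s (.q μ n)

/-- The field `p_μ(t)`. -/
noncomputable def pF (μ : Fin N) : ℤ → Module.End ℂ (Fock s N p ι) := fun n => op s (.p μ n)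

/-- The field `φ_{α,m}(t)`, where `A = (α, m)`. -/
noncomputable def phiF (A : Comp N p ι) : ℤ → Module.End ℂ (Fock s N p ι) :=
  fun n => op s (.phi A n)

/-- The field `π^{α,m}(t)`, where `A = (α, m)`. -/
noncomputable def momF (A : Comp N p ι) : ℤ → Module.End ℂ (Fock s N p ι) :=
  fun n => op s (.mom A n)

theorem gen_mul_gen (x y : Mode N p ι) :
    gen s x * gen s y = exch s x y • (gen s y * gen s x) +
      algebraMap ℂ (Heis s N p ι) (pairing s x y) := by
  have h : heisMk s N p ι _ = heisMk s N p ι _ :=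
    RingQuot.mkAlgHom_rel ℂ (HeisRel.comm (s := s) x y)
  rw [map_mul, map_add, map_smul, map_mul, AlgHom.commutes] at h
  exact h

theorem op_mul_op (x y : Mode N p ι) :
    op s x * op s y = exch s x y • (op s y * op s x) + pairing s x y • 1 := by
  unfold op
  rw [← map_mul, gen_mul_gen, map_add, map_smul, map_mul, AlgHom.commutes,
    Algebra.algebraMap_eq_smul_one]

theorem op_vac {x : Mode N p ι} (hx : x.Annihilates) : op s x (vac s) = 0 := by
  change (Submodule.Quotient.mk (gen s x * 1) : Heis s N p ι ⧸ vacIdeal s N p ι) = 0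
  rw [Submodule.Quotient.mk_eq_zero, mul_one]
  exact Submodule.subset_span ⟨x, hx, rfl⟩

theorem pairing_eq_zero {x y : Mode N p ι} (h : x.freq + y.freq ≠ 0) : pairing s x y = 0 := by
  cases x <;> cases y <;> simp only [pairing, Mode.freq] at h ⊢ <;>
    exact if_neg fun hh => h (by have := hh.2; omega)

theorem exists_freq_bound (v : Fock s N p ι) :
    ∃ K : ℤ, ∀ x : Mode N p ι, x.freq < K → op s x v = 0 := by
  have key : ∀ a : FreeAlgebra ℂ (Mode N p ι), ∀ u : Fock s N p ι,
      (∃ K : ℤ, ∀ x : Mode N p ι, x.freq < K → op s x u = 0) →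
      ∃ K : ℤ, ∀ x : Mode N p ι, x.freq < K → op s x
        (heisMk s N p ι a • u)
          = 0 := by
    intro a
    induction a using FreeAlgebra.induction with
    | grade0 r =>
      rintro u ⟨K, hK⟩
      refine ⟨K, fun x hx => ?_⟩
      have hr : heisMk s N p ι (algebraMap ℂ _ r) = algebraMap ℂ (Heis s N p ι) r :=
        AlgHom.commutes _ _
      rw [hr, algebraMap_smul, map_smul, hK x hx, smul_zero]
    | grade1 y =>
      rintro u ⟨K, hK⟩
      refine ⟨min K (-y.freq), fun x hx => ?_⟩
      change op s x (op s y u) = 0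
      have h := congrArg (fun f : Module.End ℂ (Fock s N p ι) => f u) (op_mul_op s x y)
      simp only [Module.End.mul_apply, LinearMap.add_apply, LinearMap.smul_apply] at h
      rw [h, hK x (by omega), pairing_eq_zero s (by omega)]
      simp
    | mul a b iha ihb =>
      intro u hu
      obtain ⟨K, hK⟩ := iha _ (ihb u hu)
      refine ⟨K, fun x hx => ?_⟩
      have := hK x hx
      rw [map_mul]
      rw [← mul_smul] at this
      exact this
    | add a b iha ihb =>
      intro u hu
      obtain ⟨K, hK⟩ := iha u hu
      obtain ⟨L, hL⟩ := ihb u hu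
      refine ⟨min K L, fun x hx => ?_⟩
      have h1 := hK x (by omega)
      have h2 := hL x (by omega)
      have h3 := congrArg₂ (· + ·) h1 h2
      simp only [add_zero] at h3
      rw [← map_add, ← add_smul] at h3
      rw [map_add]
      exact h3
  obtain ⟨b, rfl⟩ := Submodule.Quotient.mk_surjective (vacIdeal s N p ι) v
  obtain ⟨a, rfl⟩ := RingQuot.mkAlgHom_surjective ℂ (HeisRel (N := N) (p := p) (ι := ι) s) b
  have h := key a (vac s) ⟨0, fun x hx => op_vac s (by
    cases x <;> simp only [Mode.freq, Mode.Annihilates] at hx ⊢ <;> omega)⟩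
  have e : (heisMk s N p ι a •
      (vac s : Fock s N p ι)) =
      (Submodule.Quotient.mk (heisMk s N p ι a) :
        Heis s N p ι ⧸ vacIdeal s N p ι) := by
    change (Submodule.Quotient.mk (heisMk s N p ι a * 1) :
        Heis s N p ι ⧸ vacIdeal s N p ι) = _
    rw [mul_one]
  rw [e] at h
  exact h

theorem isField_qF (μ : Fin N) : IsField (qF s μ : ℤ → Module.End ℂ (Fock s N p ι)) := fun v =>
  (exists_freq_bound s v).imp fun _ hK n hn => hK (.q μ n) hn

theorem isField_pF (μ : Fin N) : IsField (pF s μ : ℤ → Module.End ℂ (Fock s N p ι)) := fun v =>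
  (exists_freq_bound s v).imp fun _ hK n hn => hK (.p μ n) hn

theorem isField_phiF (A : Comp N p ι) : IsField (phiF s A) := fun v =>
  (exists_freq_bound s v).imp fun _ hK n hn => hK (.phi A n) hn

theorem isField_momF (A : Comp N p ι) : IsField (momF s A) := fun v =>
  (exists_freq_bound s v).imp fun _ hK n hn => hK (.mom A n) hn

/-- The modes of the monomial `∏ d^{k_i} q^{μ_i}(t) / dt^{k_i}` in the observer's trajectory and
its derivatives, given by the list of the pairs `(k_i, μ_i)`. -/
noncomputable def obsWord : List (ℕ × Fin N) → ℤ → Module.End ℂ (Fock s N p ι)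
  | [] => fone
  | x :: l => fmul (tderiv^[x.1] (qF s x.2)) (obsWord l)

/-- The modes of `f(q(t))` for a polynomial `f`. -/
noncomputable def polyF (f : MvPolynomial (Fin N) ℂ) : ℤ → Module.End ℂ (Fock s N p ι) :=
  fun n => ∑ e ∈ f.support, f.coeff e •
    obsWord s ((List.finRange N).flatMap fun μ => List.replicate (e μ) (0, μ)) n

theorem commute_op {x y : Mode N p ι} (h1 : exch s x y = 1) (h2 : pairing s x y = 0) :
    Commute (op s x) (op s y) := by
  have h := op_mul_op s x y
  rw [h1, h2, one_smul, zero_smul, add_zero] at h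
  exact h

theorem isField_iterate {F : Type*} [AddCommGroup F] [Module ℂ F] {a : ℤ → Module.End ℂ F}
    (ha : IsField a) (k : ℕ) : IsField (tderiv^[k] a) := by
  induction k with
  | zero => exact ha
  | succ k ih =>
    rw [Function.iterate_succ_apply']
    exact ih.tderiv

theorem fieldsCommute_iterate {F : Type*} [AddCommGroup F] [Module ℂ F]
    {a b : ℤ → Module.End ℂ F} (h : FieldsCommute a b) (k : ℕ) :
    FieldsCommute a (tderiv^[k] b) := by
  induction k with
  | zero => exact h
  | succ k ih =>
    rw [Function.iterate_succ_apply']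
    exact fun m n => (ih m n).smul_right _

theorem obsWord_spec (l : List (ℕ × Fin N)) :
    IsField (obsWord s l : ℤ → Module.End ℂ (Fock s N p ι)) ∧
    ∀ a : ℤ → Module.End ℂ (Fock s N p ι), (∀ μ, FieldsCommute a (qF s μ)) →
      FieldsCommute a (obsWord s l) := by
  induction l with
  | nil =>
    refine ⟨isField_fone, fun a _ m n => ?_⟩
    by_cases h : n = 0
    · simp [obsWord, fone, h]
    · simp [obsWord, fone, h]
  | cons x l ih =>
    have h0 : IsField (tderiv^[x.1] (qF s x.2) : ℤ → Module.End ℂ (Fock s N p ι)) :=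
      isField_iterate (isField_qF s x.2) x.1
    have hq : ∀ μ ν : Fin N, FieldsCommute
        (qF s μ : ℤ → Module.End ℂ (Fock s N p ι)) (qF s ν) := fun μ ν m n =>
      commute_op s rfl rfl
    have h1 : FieldsCommute (tderiv^[x.1] (qF s x.2) : ℤ → Module.End ℂ (Fock s N p ι))
        (obsWord s l) :=
      ih.2 _ fun μ m n => (fieldsCommute_iterate (hq μ x.2) x.1 n m).symm
    exact ⟨h0.fmul ih.1 h1, fun a ha =>
      FieldsCommute.fmul_right h0 ih.1 h1 (fieldsCommute_iterate (ha x.2) x.1) (ih.2 a ha)⟩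

theorem isField_polyF (f : MvPolynomial (Fin N) ℂ) :
    IsField (polyF s f : ℤ → Module.End ℂ (Fock s N p ι)) :=
  isField_sum f.support
    (a := fun e n => f.coeff e •
      obsWord s ((List.finRange N).flatMap fun μ => List.replicate (e μ) (0, μ)) n)
    fun _ => (obsWord_spec s _).1.smul _

/-- The product of `f(q(t))` with a normal ordered product of matter fields is locally finite. -/
theorem locFin_polyF_normOrd (f : MvPolynomial (Fin N) ℂ) (σ : ℂ) (A B : Comp N p ι) (m : ℤ) :
    LocFin fun j : ℤ => polyF s f (m - j) * normOrd σ (momF s A) (phiF s B) j := by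
  refine locFin_fmul (isField_polyF s f)
    (IsField.normOrd σ (isField_momF s A) (isField_phiF s B)) (fun a b => ?_) m
  have hc : ∀ (X : ℤ → Module.End ℂ (Fock s N p ι)), (∀ μ, FieldsCommute X (qF s μ)) →
      FieldsCommute (polyF s f) X := fun X hX m n => by
    unfold polyF
    exact Commute.sum_left _ _ _ fun e _ => (((obsWord_spec s _).2 X hX n m).symm).smul_left _
  exact FieldsCommute.normOrd_right σ (isField_momF s A) (isField_phiF s B)
    (hc _ fun μ m n => commute_op s rfl rfl) (hc _ fun μ m n => commute_op s rfl rfl) a b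

end FockSpace

section Generators

variable {N p : ℕ} {ι : Type*}

/-- The iterated partial derivative `∂_r f`. -/
noncomputable def dMulti (r : Fin N → ℕ) (f : MvPolynomial (Fin N) ℂ) :
    MvPolynomial (Fin N) ℂ :=
  (List.finRange N).foldr (fun μ g => (MvPolynomial.pderiv μ)^[r μ] g) f

/-- The binomial coefficient of two multi-indices. -/
def mChoose (n m : Fin N → ℕ) : ℕ := ∏ μ, (n μ).choose (m μ)

variable [Fintype ι] [DecidableEq ι]

/-- The entry `(β, α)` of the matrix
`T^m_n(ξ) = ∑ (n choose m) ∂_{n-m+ν} ξ^μ ϱ(T^ν_μ)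
  + ∑ (n choose m-μ) (1 - δ^{m-μ}_n) ∂_{n-m+μ} ξ^μ ϱ(1)`,
a polynomial in `x`. Here `T^ν_μ` is the matrix unit `E_{νμ}`; a binomial coefficient with an
entry below that is negative or larger than the one above is zero. -/
noncomputable def tCoef (ρ : Matrix (Fin N) (Fin N) ℂ →ₗ[ℂ] Matrix ι ι ℂ)
    (ξ : Fin N → MvPolynomial (Fin N) ℂ) (n m : Fin N → ℕ) (β α : ι) :
    MvPolynomial (Fin N) ℂ :=
  (∑ μ, ∑ ν, ((mChoose n m : ℂ) * ρ (Matrix.single ν μ 1) β α) •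
    dMulti (n - m + Pi.single ν 1) (ξ μ)) +
  ∑ μ, if α = β ∧ 1 ≤ m μ ∧ m - Pi.single μ 1 ≠ n then
    (mChoose n (m - Pi.single μ 1) : ℂ) • dMulti (n - (m - Pi.single μ 1)) (ξ μ) else 0

variable (s : Stat)

/-- `ℒ_ξ = ∫ dt ( :ξ^μ(q(t)) p_μ(t): + T(ξ(q(t)), t) )` with
`T(ξ, t) = ∓ ∑_{|m| ≤ |n| ≤ p} :π^n(t) T^m_n(ξ) φ_m(t):`, for a polynomial vector field `ξ`
(the integral over the circle is `2π` times the mode of frequency zero). -/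
noncomputable def lieOp (ρ : Matrix (Fin N) (Fin N) ℂ →ₗ[ℂ] Matrix ι ι ℂ)
    (ξ : Fin N → MvPolynomial (Fin N) ℂ) : Module.End ℂ (Fock s N p ι) :=
  (2 * (Real.pi : ℂ)) •
    ((∑ μ, normOrd 1 (pF s μ) (polyF s (ξ μ)) 0) +
      (-s.sign) • ∑ n : JetIdx N p, ∑ m : JetIdx N p, if m.order ≤ n.order then
        ∑ β, ∑ α, fmul (polyF s (tCoef ρ ξ n.exps m.exps β α))
          (normOrd s.sign (momF s (β, n)) (phiF s (α, m))) 0 else 0)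

/-- The Fourier mode of frequency `m` of
`L(t) = - :q̇^μ(t) p_μ(t): ± ∑_{|m| ≤ p} ( - :π^m(t) φ̇_m(t): + λ :d/dt(π^m(t) φ_m(t)):
  + i w :π^m(t) φ_m(t): ) ± (N+p choose p) dim ϱ (λ - λ² - w + w²) / (4πi)`. -/
noncomputable def reparMode (N p : ℕ) (ι : Type*) [Fintype ι] [DecidableEq ι] (lam w : ℂ) (m : ℤ) :
    Module.End ℂ (Fock s N p ι) :=
  -(∑ μ : Fin N, normOrd 1 (pF s μ) (tderiv (qF s μ)) m) +
    s.sign • (∑ A : Comp N p ι,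
      (-normOrd s.sign (momF s A) (tderiv (phiF s A)) m +
        lam • tderiv (normOrd s.sign (momF s A) (phiF s A)) m +
        (Complex.I * w) • normOrd s.sign (momF s A) (phiF s A) m)) +
    (s.sign * ((N + p).choose p : ℂ) * (Fintype.card ι : ℂ) *
      ((lam - lam ^ 2 - w + w ^ 2) / (4 * (Real.pi : ℂ) * Complex.I))) • fone m

/-- `L̂(m) = -i ∫ dt e^{imt} L(t)`. -/
noncomputable def repar (N p : ℕ) (ι : Type*) [Fintype ι] [DecidableEq ι] (lam w : ℂ) (m : ℤ) :
    Module.End ℂ (Fock s N p ι) :=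
  (-Complex.I * (2 * (Real.pi : ℂ))) • reparMode s N p ι lam w m

/-- The Hamiltonian `H = -i ∫ dt L(t)`. -/
noncomputable def ham (N p : ℕ) (ι : Type*) [Fintype ι] [DecidableEq ι] (lam w : ℂ) :
    Module.End ℂ (Fock s N p ι) := repar s N p ι lam w 0

/-- The associative algebra generated by the operators of the `DRO(N)` module `J^p F`:
the `ℒ_ξ` of polynomial vector fields, the modes of `L(t)`, and the modes of the polynomials
in the observer's trajectory and its derivatives. -/
noncomputable def droAlg (ρ : Matrix (Fin N) (Fin N) ℂ →ₗ[ℂ] Matrix ι ι ℂ) (p : ℕ) (lam w : ℂ) :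
    Subalgebra ℂ (Module.End ℂ (Fock s N p ι)) :=
  Algebra.adjoin ℂ
    ((Set.range fun ξ : Fin N → MvPolynomial (Fin N) ℂ => lieOp s ρ ξ) ∪
      (Set.range fun m : ℤ => repar s N p ι lam w m) ∪
      Set.range fun x : List (ℕ × Fin N) × ℤ => obsWord s x.1 x.2)

/-- A cyclic state: a nonzero vector annihilated by the modes of negative frequency of `L(t)`. -/
def IsCyclicState (lam w : ℂ) (v : Fock s N p ι) : Prop :=
  v ≠ 0 ∧ ∀ m : ℤ, m < 0 → reparMode s N p ι lam w m v = 0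

/-- The vector has energy `E`, that is `H v = E v`. -/
def HasEnergy (lam w : ℂ) (v : Fock s N p ι) (E : ℂ) : Prop :=
  ham s N p ι lam w v = E • v

/-- The submodule generated by `v` does not contain the vacuum, and the one generated by the
vacuum does not contain `v`. -/
def SeparatedFromVacuum (ρ : Matrix (Fin N) (Fin N) ℂ →ₗ[ℂ] Matrix ι ι ℂ) (lam w : ℂ)
    (v : Fock s N p ι) : Prop :=
  vac s ∉ Submodule.span (droAlg s ρ p lam w) {v} ∧
    v ∉ Submodule.span (droAlg s ρ p lam w) {(vac s : Fock s N p ι)}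

/-- `h = ∓ (1/2) (N+p choose p) dim ϱ ((w - 1/2)² - (λ - 1/2)²)`. -/
noncomputable def lowestEnergy (N p dimRho : ℕ) (lam w : ℂ) : ℂ :=
  -s.sign * (1 / 2) * ((N + p).choose p : ℂ) * (dimRho : ℂ) *
    ((w - 1 / 2) ^ 2 - (lam - 1 / 2) ^ 2)

/-- The product of the modes `φ̂_A(n)` over the list of components `o`. -/
noncomputable def phiProd (o : List (Comp N p ι)) (n : ℤ) : Module.End ℂ (Fock s N p ι) :=
  (o.map fun A => phiF s A n).prod

/-- The product of the modes `π̂^A(n)` over the list of components `o`. -/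
noncomputable def momProd (o : List (Comp N p ι)) (n : ℤ) : Module.End ℂ (Fock s N p ι) :=
  (o.map fun A => momF s A n).prod

/-- `X(a+k-1) ⋯ X(a+1) X(a) |0⟩`. -/
noncomputable def stack (X : ℤ → Module.End ℂ (Fock s N p ι)) (a : ℤ) : ℕ → Fock s N p ι
  | 0 => vac s
  | k + 1 => X (a + k) (stack X a k)

/-- The list `o` runs through the components that satisfy `P`, each exactly once. -/
def Enumerates (o : List (Comp N p ι)) (P : Comp N p ι → Prop) : Prop :=
  o.Nodup ∧ ∀ A, A ∈ o ↔ P A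

end Generators

end DRO

set_option linter.unusedSectionVars false

namespace DRO

/-! ### Commutators of normal ordered products with a single operator -/

section Commutators

variable {F : Type*} [AddCommGroup F] [Module ℂ F]

/-! Everything rests on the commutator of a mode of `L(t)` with one phase space mode: it is a
multiple of the mode of the same field with shifted frequency (`repar_mul_op`). Commutators of the
modes of `L(t)` with each other are never needed.

Cyclicity. If a mode of `L(t)` of frequency `m < 0` kills `v`, then it kills `x v` as soon as the
shifted mode `x.shift m` kills `v` (`reparMode_op_eq_zero`). For powers of the bosonic zero mode,
the shifted mode commutes through to the vacuum and annihilates it. For fermions, the shifted mode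
is a lower level of the same component, which is already occupied, so the Pauli principle applies
(`Filled.op`). The states are non-zero because conjugate modes strip off their factors one by one,
down to the vacuum; the vacuum is non-zero because the commutation relations have a concrete model
(`vac_ne_zero`).

Energy. At `m = 0` the commutator says that a mode adds its frequency plus `w` times its charge, so
the energies are arithmetic sums.

Separation. All operators of the algebra conserve the charge, the number of `φ̂` minus the number of
`π̂` (`raisesCharge_of_mem_droAlg`), and spaces of different charge meet only in zero
(`eq_zero_of_mem_charged`). Hence a non-zero state of non-zero charge and the vacuum do not lie in
each other's submodules, which also gives reducibility. In charge zero the energies are `h + f` with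
integers `f ≥ 0`, so an operator of the algebra that lowers the energy kills the vacuum
(`apply_vac_eq_zero`). -/

theorem lsum_mul_eq {I : Type*} [DecidableEq I] {T : I → Module.End ℂ F} (h : LocFin T)
    {X Z : Module.End ℂ F} (i₀ : I)
    (hX : ∀ i, T i * X = X * T i + if i = i₀ then Z else 0) :
    lsum T * X = X * lsum T + Z := by
  ext v
  simp only [Module.End.mul_apply, LinearMap.add_apply]
  rw [lsum_apply h, lsum_apply h, map_finsum X (h v)]
  have e : ∀ i, T i (X v) = X (T i v) + if i = i₀ then Z v else 0 := fun i => by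
    have := congrArg (fun f : Module.End ℂ F => f v) (hX i)
    simp only [Module.End.mul_apply, LinearMap.add_apply] at this
    rw [this]
    split_ifs <;> simp
  rw [finsum_congr e, finsum_add_distrib]
  · rw [finsum_eq_single _ i₀ (fun i hi => if_neg hi), if_pos rfl]
  · exact (h v).subset fun i hi => by
      rw [Function.mem_support] at hi ⊢
      exact fun h0 => hi (by rw [h0, map_zero])
  · exact (Set.finite_singleton i₀).subset fun i hi => by
      by_contra hne
      exact hi (if_neg hne)

/-- The commutator of a normal ordered product with an operator that pairs with `Φ`. -/
theorem normOrd_mul_left {σ ε e : ℂ} {P Φ : ℤ → Module.End ℂ F} (hP : IsField P)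
    (hΦ : IsField Φ) {X : Module.End ℂ F} {n : ℤ} (hε : ε * ε = 1) (he : σ * ε * e = e)
    (h1 : ∀ j, P j * X = ε • (X * P j))
    (h2 : ∀ k, Φ k * X = ε • (X * Φ k) + (if k = -n then e else 0) • 1) (m : ℤ) :
    normOrd σ P Φ m * X = X * normOrd σ P Φ m + e • P (m + n) := by
  refine lsum_mul_eq (locFin_normOrd σ hP hΦ m) (m + n) fun j => ?_
  have hr : (if j = m + n then e • P (m + n) else 0) = (if m - j = -n then e else 0) • P j := by
    have hk : m - j = -n ↔ j = m + n := by omega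
    simp only [hk]
    split_ifs with h
    · rw [h]
    · rw [zero_smul]
  -- For `j ≤ 0` the contraction carries the factor `σ * ε`. The hypothesis `he` removes it; it
  -- covers both `ε = σ` with `σ * σ = 1` and the case `e = 0`, where `ε` may differ from `σ`.
  have hd : σ * ε * (if m - j = -n then e else 0) = if m - j = -n then e else 0 := by
    split_ifs
    · exact he
    · exact mul_zero _
  have h2k := h2 (m - j)
  rw [hr]
  generalize (if m - j = -n then e else 0) = d at h2k hd ⊢
  split_ifs
  · rw [mul_assoc, h2k, mul_add, mul_smul_comm, ← mul_assoc, h1, smul_mul_assoc,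
      smul_smul, hε, one_smul, mul_smul_comm, mul_one, mul_assoc]
  · rw [smul_mul_assoc, mul_assoc, h1, mul_smul_comm, ← mul_assoc, h2k, add_mul,
      smul_mul_assoc, smul_mul_assoc, one_mul, smul_add, smul_add, smul_smul ε ε, hε, one_smul,
      smul_smul, smul_smul, hd, mul_smul_comm, mul_assoc]

/-- The commutator of a normal ordered product with an operator that pairs with `P`. -/
theorem normOrd_mul_right {σ c : ℂ} {P Φ : ℤ → Module.End ℂ F} (hP : IsField P)
    (hΦ : IsField Φ) {X : Module.End ℂ F} {n : ℤ} (hσ : σ * σ = 1)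
    (h1 : ∀ j, P j * X = σ • (X * P j) + (if j = -n then c else 0) • 1)
    (h2 : ∀ k, Φ k * X = σ • (X * Φ k)) (m : ℤ) :
    normOrd σ P Φ m * X = X * normOrd σ P Φ m + (σ * c) • Φ (m + n) := by
  refine lsum_mul_eq (locFin_normOrd σ hP hΦ m) (-n) fun j => ?_
  have hr : (if j = -n then (σ * c) • Φ (m + n) else 0) =
      (σ * if j = -n then c else 0) • Φ (m - j) := by
    split_ifs with h
    · rw [h, sub_neg_eq_add]
    · rw [mul_zero, zero_smul]
  rw [hr]
  have h1j := h1 j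
  generalize (if j = -n then c else 0) = d at h1j ⊢
  split_ifs
  · rw [mul_assoc, h2, mul_smul_comm, ← mul_assoc, h1j, add_mul, smul_mul_assoc, smul_mul_assoc,
      one_mul, smul_add, smul_smul, hσ, one_smul, smul_smul, mul_assoc]
  · rw [smul_mul_assoc, mul_assoc, h1j, mul_add, mul_smul_comm, ← mul_assoc, h2, smul_mul_assoc,
      smul_smul, hσ, one_smul, mul_smul_comm, mul_one, smul_add, smul_smul, mul_smul_comm,
      mul_assoc]

/-- Normal ordering puts an annihilator on the right of every summand: `P j` if `j ≤ 0`, and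
otherwise `Φ (m - j)` with `m - j < 0`. -/
theorem normOrd_apply_eq_zero {σ : ℂ} {P Φ : ℤ → Module.End ℂ F} (hP : IsField P)
    (hΦ : IsField Φ) {v : F} (h1 : ∀ j ≤ 0, P j v = 0) (h2 : ∀ j < 0, Φ j v = 0) {m : ℤ}
    (hm : m ≤ 0) : normOrd σ P Φ m v = 0 := by
  unfold normOrd
  rw [lsum_apply (locFin_normOrd σ hP hΦ m)]
  refine finsum_eq_zero_of_forall_eq_zero fun j => ?_
  split_ifs with h
  · rw [Module.End.mul_apply, h2 _ (by omega), map_zero]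
  · rw [LinearMap.smul_apply, Module.End.mul_apply, h1 _ (by omega), map_zero, smul_zero]

end Commutators

/-! ### Commutators of `L(t)` with the phase space modes, and its action on the vacuum -/

section Modes

variable {N p : ℕ} {ι : Type*}

/-- The mode of the same field with the frequency raised by `m`. -/
def Mode.shift (m : ℤ) : Mode N p ι → Mode N p ι
  | .q μ n => .q μ (m + n)
  | .p μ n => .p μ (m + n)
  | .phi A n => .phi A (m + n)
  | .mom A n => .mom A (m + n)

/-- The charge of a mode: `1` for `φ̂`, `-1` for `π̂`. -/
def Mode.charge : Mode N p ι → ℤ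
  | .q _ _ => 0
  | .p _ _ => 0
  | .phi _ _ => 1
  | .mom _ _ => -1

/-- The coefficient in the commutator of a mode of `L(t)` with a phase space mode. -/
def Mode.reparCoeff (lam w : ℂ) (m : ℤ) : Mode N p ι → ℂ
  | .q _ n => m + n
  | .p _ n => n
  | .phi _ n => m + n - lam * m + w
  | .mom _ n => n + lam * m - w

theorem Mode.shift_zero (x : Mode N p ι) : x.shift 0 = x := by
  cases x <;> simp [Mode.shift]

theorem Mode.reparCoeff_zero (lam w : ℂ) (x : Mode N p ι) :
    x.reparCoeff lam w 0 = x.freq + w * x.charge := by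
  cases x <;> simp [Mode.reparCoeff, Mode.freq, Mode.charge]; ring

theorem Stat.sign_mul_sign (s : Stat) : s.sign * s.sign = 1 := by
  cases s <;> simp [Stat.sign]

variable [DecidableEq ι]

/-- The coefficient in the commutator of `:p_μ(t) (Dq^μ)(t):` with a phase space mode, where `D` is
the Fourier multiplier `d`. -/
noncomputable def Mode.trajCoeff (d : ℤ → ℂ) (μ : Fin N) (m : ℤ) : Mode N p ι → ℂ
  | .q ν n => if μ = ν then d (m + n) / (2 * (Real.pi : ℂ)) else 0
  | .p ν n => if μ = ν then -d (-n) / (2 * (Real.pi : ℂ)) else 0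
  | _ => 0

/-- The coefficient in the commutator of `:π^A(t) (Dφ_A)(t):` with a phase space mode, where `D` is
the Fourier multiplier `d`. -/
noncomputable def Mode.matterCoeff (σ : ℂ) (d : ℤ → ℂ) (A : Comp N p ι) (m : ℤ) :
    Mode N p ι → ℂ
  | .phi B n => if A = B then σ * d (m + n) / (2 * (Real.pi : ℂ)) else 0
  | .mom B n => if A = B then -σ * d (-n) / (2 * (Real.pi : ℂ)) else 0
  | _ => 0

variable (s : Stat)

theorem smul_op_mul_op (c : ℂ) (x y : Mode N p ι) :
    (c • op s x) * op s y = exch s x y • (op s y * (c • op s x)) + (c * pairing s x y) • 1 := by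
  rw [smul_mul_assoc, op_mul_op, smul_add, mul_smul_comm, smul_smul, smul_smul, smul_smul,
    mul_comm c]

/-- A `q̂` contracts with the factor `p` and leaves the other factor at frequency `m + n`; a `p̂`
contracts with the mode of `Φ` of frequency `-n` and leaves a `p̂`. This is where the multiplier `d`
gets its arguments. -/
theorem normOrd_pF_mul {d : ℤ → ℂ} (μ : Fin N) {Φ : ℤ → Module.End ℂ (Fock s N p ι)}
    (hF : IsField Φ) (hΦ : ∀ k, Φ k = d k • qF s μ k) (x : Mode N p ι) (m : ℤ) :
    normOrd 1 (pF s μ) Φ m * op s x =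
      op s x * normOrd 1 (pF s μ) Φ m + x.trajCoeff d μ m • op s (x.shift m) := by
  have hP := isField_pF (N := N) (p := p) (ι := ι) s μ
  have hz : (∀ j, exch s (.p μ j) x = 1 ∧ pairing s (.p μ j) x = 0) →
      (∀ j, exch s (.q μ j) x = 1 ∧ pairing s (.q μ j) x = 0) →
      normOrd 1 (pF s μ) Φ m * op s x = op s x * normOrd 1 (pF s μ) Φ m := fun h1 h2 => by
    have := normOrd_mul_left (σ := 1) (ε := 1) hP hF (X := op s x) (n := 0)
      (e := 0) (by norm_num) (by ring)
      (fun j => by rw [pF, op_mul_op, (h1 j).1, (h1 j).2, zero_smul, add_zero])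
      (fun j => by rw [hΦ, qF, smul_op_mul_op, (h2 j).1, (h2 j).2, mul_zero, ite_self]) m
    rw [this, zero_smul, add_zero]
  cases x with
  | q ν n =>
    by_cases h : μ = ν
    · subst h
      rw [normOrd_mul_right (σ := 1) hP hF (X := op s (.q μ n)) (n := n)
        (c := 1 / (2 * (Real.pi : ℂ))) (by norm_num)
        (fun j => by
          rw [pF, op_mul_op]
          simp only [exch, Mode.isMatter, pairing, Bool.and_self, true_and]
          simp [← eq_neg_iff_add_eq_zero])
        (fun j => by
          rw [hΦ, qF, smul_op_mul_op]
          simp [exch, Mode.isMatter, pairing]) m]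
      rw [hΦ, qF, smul_smul, Mode.trajCoeff, if_pos rfl, Mode.shift]
      congr 2; ring
    · rw [hz (fun j => by simp [exch, Mode.isMatter, pairing, h])
        (fun j => by simp [exch, Mode.isMatter, pairing]), Mode.trajCoeff, if_neg h, zero_smul,
        add_zero]
  | p ν n =>
    by_cases h : μ = ν
    · subst h
      rw [normOrd_mul_left (σ := 1) (ε := 1) hP hF (X := op s (.p μ n)) (n := n)
        (e := -d (-n) / (2 * (Real.pi : ℂ))) (by norm_num) (by ring)
        (fun j => by
          rw [pF, op_mul_op]
          simp [exch, Mode.isMatter, pairing])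
        (fun j => by
          rw [hΦ, qF, smul_op_mul_op]
          simp only [exch, Mode.isMatter, pairing, true_and]
          congr 2
          by_cases hj : j = -n
          · subst hj
            rw [if_pos (by ring), if_pos rfl]; ring
          · rw [if_neg (by omega), if_neg hj, mul_zero]) m]
      rw [Mode.trajCoeff, if_pos rfl, Mode.shift, pF]
    · rw [hz (fun j => by simp [exch, Mode.isMatter, pairing])
        (fun j => by simp [exch, Mode.isMatter, pairing, Ne.symm h]), Mode.trajCoeff, if_neg h,
        zero_smul, add_zero]
  | phi A n =>
    rw [hz (fun j => by simp [exch, Mode.isMatter, pairing])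
      (fun j => by simp [exch, Mode.isMatter, pairing])]
    simp [Mode.trajCoeff]
  | mom A n =>
    rw [hz (fun j => by simp [exch, Mode.isMatter, pairing])
      (fun j => by simp [exch, Mode.isMatter, pairing])]
    simp [Mode.trajCoeff]

theorem normOrd_momF_mul {d : ℤ → ℂ} (A : Comp N p ι) {Φ : ℤ → Module.End ℂ (Fock s N p ι)}
    (hF : IsField Φ) (hΦ : ∀ k, Φ k = d k • phiF s A k) (x : Mode N p ι) (m : ℤ) :
    normOrd s.sign (momF s A) Φ m * op s x =
      op s x * normOrd s.sign (momF s A) Φ m + x.matterCoeff s.sign d A m • op s (x.shift m) := by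
  have hP := isField_momF (N := N) (p := p) (ι := ι) s A
  have hs := s.sign_mul_sign
  -- Modes without contraction. The sign `ε` is left free: it is `1` for trajectory modes and
  -- `s.sign` for the other matter modes.
  have hz : ∀ ε : ℂ, ε * ε = 1 → (∀ j, exch s (.mom A j) x = ε ∧ pairing s (.mom A j) x = 0) →
      (∀ j, exch s (.phi A j) x = ε ∧ pairing s (.phi A j) x = 0) →
      normOrd s.sign (momF s A) Φ m * op s x = op s x * normOrd s.sign (momF s A) Φ m :=
    fun ε hε h1 h2 => by
    have := normOrd_mul_left (σ := s.sign) (ε := ε) hP hF (X := op s x) (n := 0)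
      (e := 0) hε (by ring)
      (fun j => by rw [momF, op_mul_op, (h1 j).1, (h1 j).2, zero_smul, add_zero])
      (fun j => by rw [hΦ, phiF, smul_op_mul_op, (h2 j).1, (h2 j).2, mul_zero, ite_self]) m
    rw [this, zero_smul, add_zero]
  cases x with
  | q ν n =>
    rw [hz 1 (one_mul 1) (fun j => by simp [exch, Mode.isMatter, pairing])
      (fun j => by simp [exch, Mode.isMatter, pairing])]
    simp [Mode.matterCoeff]
  | p ν n =>
    rw [hz 1 (one_mul 1) (fun j => by simp [exch, Mode.isMatter, pairing])
      (fun j => by simp [exch, Mode.isMatter, pairing])]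
    simp [Mode.matterCoeff]
  | phi B n =>
    by_cases h : A = B
    · subst h
      rw [normOrd_mul_right hP hF (X := op s (.phi A n)) (n := n)
        (c := 1 / (2 * (Real.pi : ℂ))) hs
        (fun j => by
          rw [momF, op_mul_op]
          simp only [exch, Mode.isMatter, pairing, Bool.and_self, true_and]
          simp [← eq_neg_iff_add_eq_zero])
        (fun j => by
          rw [hΦ, phiF, smul_op_mul_op]
          simp [exch, Mode.isMatter, pairing]) m]
      rw [hΦ, phiF, smul_smul, Mode.matterCoeff, if_pos rfl, Mode.shift]
      congr 2; ring
    · rw [hz s.sign hs (fun j => by simp [exch, Mode.isMatter, pairing, h])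
        (fun j => by simp [exch, Mode.isMatter, pairing]), Mode.matterCoeff, if_neg h, zero_smul,
        add_zero]
  | mom B n =>
    by_cases h : A = B
    · subst h
      rw [normOrd_mul_left (ε := s.sign) hP hF (X := op s (.mom A n)) (n := n)
        (e := -s.sign * d (-n) / (2 * (Real.pi : ℂ))) hs (by rw [hs, one_mul])
        (fun j => by
          rw [momF, op_mul_op]
          simp [exch, Mode.isMatter, pairing])
        (fun j => by
          rw [hΦ, phiF, smul_op_mul_op]
          simp only [exch, Mode.isMatter, pairing, true_and, Bool.and_self, if_true]
          congr 2
          by_cases hj : j = -n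
          · subst hj
            rw [if_pos (by ring), if_pos rfl]; ring
          · rw [if_neg (by omega), if_neg hj, mul_zero]) m]
      rw [Mode.matterCoeff, if_pos rfl, Mode.shift, momF]
    · rw [hz s.sign hs (fun j => by simp [exch, Mode.isMatter, pairing])
        (fun j => by simp [exch, Mode.isMatter, pairing, Ne.symm h]), Mode.matterCoeff, if_neg h,
        zero_smul, add_zero]

variable [Fintype ι]

/-- `L(t)` is quadratic up to a scalar, so one contraction leaves a linear expression. The
contraction is diagonal in the components, which is why only the same field at frequency `m + n`
appears. -/
theorem repar_mul_op (lam w : ℂ) (m : ℤ) (x : Mode N p ι) :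
    repar s N p ι lam w m * op s x = op s x * repar s N p ι lam w m +
      x.reparCoeff lam w m • op s (x.shift m) := by
  have h1 : ∀ μ : Fin N, normOrd 1 (pF s μ) (tderiv (qF s μ)) m * op s x = _ := fun μ =>
    normOrd_pF_mul (d := fun k => -Complex.I * k) s μ (isField_qF s μ).tderiv (fun k => rfl) x m
  have h2 : ∀ A, normOrd s.sign (momF s A) (tderiv (phiF s A)) m * op s x = _ := fun A =>
    normOrd_momF_mul (d := fun k => -Complex.I * k) s A (isField_phiF s A).tderiv
      (fun k => rfl) x m
  have h3 : ∀ A, normOrd s.sign (momF s A) (phiF s A) m * op s x = _ := fun A =>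
    normOrd_momF_mul (d := fun _ => 1) s A (isField_phiF s A) (fun k => (one_smul _ _).symm) x m
  have h4 : (fone m : Module.End ℂ (Fock s N p ι)) * op s x = op s x * fone m := by
    unfold fone
    split_ifs <;> simp
  -- The total derivative in the `λ` term acts on the whole product at frequency `m` and so
  -- contributes `-i m`, whereas the derivative of `φ` alone enters through the multiplier `-i k`.
  set c := (-∑ μ, x.trajCoeff (fun k => -Complex.I * k) μ m) +
    s.sign * ∑ A, (-x.matterCoeff s.sign (fun k => -Complex.I * k) A m +
      (lam * (-Complex.I * m) + Complex.I * w) * x.matterCoeff s.sign (fun _ => 1) A m) with hc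
  have h5 : reparMode s N p ι lam w m * op s x = op s x * reparMode s N p ι lam w m +
      c • op s (x.shift m) := by
    have e1 : (∑ μ : Fin N, normOrd 1 (pF s μ) (tderiv (qF s μ)) m) * op s x =
        op s x * (∑ μ : Fin N, normOrd 1 (pF s μ) (tderiv (qF s μ)) m) +
        (∑ μ, x.trajCoeff (fun k => -Complex.I * k) μ m) • op s (x.shift m) := by
      rw [Finset.sum_mul, Finset.mul_sum, Finset.sum_smul, ← Finset.sum_add_distrib]
      exact Finset.sum_congr rfl fun μ _ => h1 μ
    have e2 : (∑ A : Comp N p ι,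
        (-normOrd s.sign (momF s A) (tderiv (phiF s A)) m +
          lam • tderiv (normOrd s.sign (momF s A) (phiF s A)) m +
          (Complex.I * w) • normOrd s.sign (momF s A) (phiF s A) m)) * op s x =
        op s x * (∑ A : Comp N p ι,
        (-normOrd s.sign (momF s A) (tderiv (phiF s A)) m +
          lam • tderiv (normOrd s.sign (momF s A) (phiF s A)) m +
          (Complex.I * w) • normOrd s.sign (momF s A) (phiF s A) m)) +
        (∑ A, (-x.matterCoeff s.sign (fun k => -Complex.I * k) A m +
          (lam * (-Complex.I * m) + Complex.I * w) * x.matterCoeff s.sign (fun _ => 1) A m)) •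
          op s (x.shift m) := by
      rw [Finset.sum_mul, Finset.mul_sum, Finset.sum_smul, ← Finset.sum_add_distrib]
      refine Finset.sum_congr rfl fun A _ => ?_
      simp only [tderiv] at h2 ⊢
      simp only [add_mul, mul_add, neg_mul, smul_mul_assoc, h2, h3, mul_smul_comm, mul_neg]
      module
    unfold reparMode
    rw [add_mul, add_mul, neg_mul, smul_mul_assoc, smul_mul_assoc, e1, e2, h4, hc]
    simp only [mul_add, mul_neg, mul_smul_comm, smul_add, add_smul, neg_add, mul_smul, neg_smul]
    abel
  have hpi : (Real.pi : ℂ) ≠ 0 := Complex.ofReal_ne_zero.2 Real.pi_ne_zero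
  have hs : s.sign ^ 2 = 1 := (sq _).trans s.sign_mul_sign
  -- The prefactor `-2πi` of `repar` cancels the `1/(2π)` of the delta function and the factors `i`
  -- in `L(t)`; the two statistics signs multiply to `1`.
  have hcc : (-Complex.I * (2 * (Real.pi : ℂ))) * c = x.reparCoeff lam w m := by
    have hI := Complex.I_mul_I
    rw [hc]
    cases x with
    | q ν n =>
      simp [Mode.trajCoeff, Mode.matterCoeff, Mode.reparCoeff]
      field_simp
      linear_combination (-(m + n) : ℂ) * hI
    | p ν n =>
      simp [Mode.trajCoeff, Mode.matterCoeff, Mode.reparCoeff]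
      field_simp
      linear_combination (-n : ℂ) * hI
    | phi B n =>
      simp [Mode.trajCoeff, Mode.matterCoeff, Mode.reparCoeff, Finset.sum_add_distrib]
      field_simp
      rw [Complex.I_sq, hs]
      ring
    | mom B n =>
      simp [Mode.trajCoeff, Mode.matterCoeff, Mode.reparCoeff, Finset.sum_add_distrib]
      field_simp
      rw [Complex.I_sq, hs]
      ring
  unfold repar
  rw [smul_mul_assoc, h5, mul_smul_comm, smul_add, smul_smul, hcc]

theorem ham_mul_op (lam w : ℂ) (x : Mode N p ι) :
    ham s N p ι lam w * op s x = op s x * ham s N p ι lam w +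
      (x.freq + w * x.charge : ℂ) • op s x := by
  have := repar_mul_op s lam w 0 x
  rwa [Mode.reparCoeff_zero, Mode.shift_zero] at this

/-- The normal ordered terms vanish on the vacuum, so only the additive constant of `L(t)` survives;
`-2πi` times this constant is the lowest energy after completing squares. -/
theorem repar_vac (lam w : ℂ) {m : ℤ} (hm : m ≤ 0) :
    repar s N p ι lam w m (vac s) =
      (if m = 0 then lowestEnergy s N p (Fintype.card ι) lam w else 0) • vac s := by
  have hp : ∀ (μ : Fin N) (j : ℤ), j ≤ 0 → pF s μ j (vac s : Fock s N p ι) = 0 :=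
    fun μ j hj => op_vac s (x := .p μ j) hj
  have hq : ∀ (μ : Fin N) (j : ℤ), j < 0 → qF s μ j (vac s : Fock s N p ι) = 0 :=
    fun μ j hj => op_vac s (x := .q μ j) hj
  have hπ : ∀ (A : Comp N p ι) (j : ℤ), j ≤ 0 → momF s A j (vac s : Fock s N p ι) = 0 :=
    fun A j hj => op_vac s (x := .mom A j) hj
  have hφ : ∀ (A : Comp N p ι) (j : ℤ), j < 0 → phiF s A j (vac s : Fock s N p ι) = 0 :=
    fun A j hj => op_vac s (x := .phi A j) hj
  have h1 : ∀ μ : Fin N,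
      normOrd 1 (pF s μ) (tderiv (qF s μ)) m (vac s : Fock s N p ι) = 0 := fun μ =>
    normOrd_apply_eq_zero (isField_pF s μ) (isField_qF s μ).tderiv (hp μ)
      (fun j hj => by simp [tderiv, hq μ j hj]) hm
  have h2 : ∀ A : Comp N p ι,
      normOrd s.sign (momF s A) (tderiv (phiF s A)) m (vac s : Fock s N p ι) = 0 := fun A =>
    normOrd_apply_eq_zero (isField_momF s A) (isField_phiF s A).tderiv (hπ A)
      (fun j hj => by simp [tderiv, hφ A j hj]) hm
  have h3 : ∀ A : Comp N p ι,
      normOrd s.sign (momF s A) (phiF s A) m (vac s : Fock s N p ι) = 0 := fun A =>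
    normOrd_apply_eq_zero (isField_momF s A) (isField_phiF s A) (hπ A) (hφ A) hm
  have hpi : (Real.pi : ℂ) ≠ 0 := Complex.ofReal_ne_zero.2 Real.pi_ne_zero
  unfold repar reparMode
  simp only [LinearMap.smul_apply, LinearMap.add_apply, LinearMap.neg_apply, LinearMap.sum_apply,
    h1, h2, h3, tderiv, smul_zero, neg_zero, add_zero, Finset.sum_const_zero, zero_add, fone]
  split_ifs
  · rw [Module.End.one_apply, smul_smul]
    congr 1
    unfold lowestEnergy
    field_simp
    ring
  · simp

end Modes

/-! ### Concrete models of the commutation relations -/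

section Oscillators

theorem pderiv_pderiv_comm {I : Type*} [DecidableEq I] (i j : I) (f : MvPolynomial I ℂ) :
    MvPolynomial.pderiv i (MvPolynomial.pderiv j f) =
      MvPolynomial.pderiv j (MvPolynomial.pderiv i f) := by
  induction f using MvPolynomial.induction_on with
  | C a => simp
  | add f g hf hg => simp only [map_add, hf, hg]
  | mul_X f n ih =>
    have h1 : ∀ k l : I, MvPolynomial.pderiv k ((Pi.single l 1 : I → MvPolynomial I ℂ) n) = 0 :=
      fun k l => by
        by_cases h : n = l
        · subst h
          simp
        · simp [Pi.single_eq_of_ne h]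
    simp only [Derivation.leibniz, MvPolynomial.pderiv_X, map_add, smul_eq_mul, h1, ih, mul_zero,
      zero_add]
    ring

theorem pderiv_X_mul {I : Type*} [DecidableEq I] (i j : I) (f : MvPolynomial I ℂ) :
    MvPolynomial.pderiv i (MvPolynomial.X j * f) =
      MvPolynomial.X j * MvPolynomial.pderiv i f + (if i = j then 1 else 0 : ℂ) • f := by
  rw [Derivation.leibniz, MvPolynomial.pderiv_X, smul_eq_mul, smul_eq_mul]
  by_cases h : i = j
  · subst h
    simp
  · simp [h]

/-- The model is the exterior algebra, realised as the Clifford algebra of the zero form: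
multiplication by basis vectors creates, contraction with the dual coordinates annihilates, and the
mixed relation is the antiderivation rule of the contraction. -/
theorem exists_fermionic_oscillators (I : Type*) [DecidableEq I] :
    ∃ cr an : I → Module.End ℂ (CliffordAlgebra (0 : QuadraticForm ℂ (I →₀ ℂ))),
      (∀ i, an i 1 = 0) ∧ (∀ i j, cr i * cr j = -(cr j * cr i)) ∧
      (∀ i j, an i * an j = -(an j * an i)) ∧
      (∀ i j, an i * cr j = -(cr j * an i) + (if i = j then 1 else 0 : ℂ) • 1) := by
  let e : I → CliffordAlgebra (0 : QuadraticForm ℂ (I →₀ ℂ)) :=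
    fun i => CliffordAlgebra.ι 0 (Finsupp.single i 1)
  let d : I → Module.Dual ℂ (I →₀ ℂ) := fun i => Finsupp.lapply i
  have he : ∀ i j f, e i * (e j * f) = -(e j * (e i * f)) := fun i j f => by
    have := CliffordAlgebra.ι_mul_ι_add_swap (Q := (0 : QuadraticForm ℂ (I →₀ ℂ)))
      (Finsupp.single i 1) (Finsupp.single j 1)
    rw [← mul_assoc, ← mul_assoc,
      eq_neg_of_add_eq_zero_left (this.trans (by simp [QuadraticMap.polar])), neg_mul]
  refine ⟨fun i => LinearMap.mulLeft ℂ (e i), fun i => CliffordAlgebra.contractLeft (d i),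
    fun i => CliffordAlgebra.contractLeft_one _ (d i), fun i j => LinearMap.ext fun f => he i j f,
    fun i j => LinearMap.ext fun f => CliffordAlgebra.contractLeft_comm (d i) (d j) f,
    fun i j => LinearMap.ext fun f => ?_⟩
  have h := CliffordAlgebra.contractLeft_ι_mul (Q := (0 : QuadraticForm ℂ (I →₀ ℂ)))
    (d i) (Finsupp.single j 1) f
  have hd : d i (Finsupp.single j 1) = if i = j then 1 else 0 := by
    simp only [d, Finsupp.lapply_apply, Finsupp.single_apply, eq_comm]
  rw [hd, sub_eq_neg_add] at h
  exact h

/-- Creation and annihilation operators with (anti)commutation relations exist on a space with a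
nonzero vacuum. -/
theorem exists_oscillators.{u} (s : Stat) (I : Type u) [DecidableEq I] :
    ∃ (M : Type u) (_ : AddCommGroup M) (_ : Module ℂ M) (cr an : I → Module.End ℂ M) (Ω : M),
      Ω ≠ 0 ∧ (∀ i, an i Ω = 0) ∧
      (∀ i j, cr i * cr j = s.sign • (cr j * cr i)) ∧
      (∀ i j, an i * an j = s.sign • (an j * an i)) ∧
      (∀ i j, an i * cr j = s.sign • (cr j * an i) + (if i = j then 1 else 0 : ℂ) • 1) := by
  cases s with
  | boson =>
    -- The bosonic model: variables act by multiplication, annihilators are partial derivatives, and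
    -- the vacuum is the constant `1`.
    refine ⟨MvPolynomial I ℂ, inferInstance, inferInstance,
      fun i => LinearMap.mulLeft ℂ (MvPolynomial.X i),
      fun i => (MvPolynomial.pderiv i : Derivation ℂ (MvPolynomial I ℂ) (MvPolynomial I ℂ)), 1,
      one_ne_zero, fun i => ?_, fun i j => ?_, fun i j => ?_, fun i j => ?_⟩
    · exact (MvPolynomial.pderiv i).map_one_eq_zero
    · rw [Stat.sign, one_smul]
      exact LinearMap.ext fun f => mul_left_comm _ _ _
    · rw [Stat.sign, one_smul]
      exact LinearMap.ext fun f => pderiv_pderiv_comm i j f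
    · rw [Stat.sign, one_smul]
      exact LinearMap.ext fun f => pderiv_X_mul i j f
  | fermion =>
    obtain ⟨cr, an, h0, h1, h2, h3⟩ := exists_fermionic_oscillators I
    exact ⟨CliffordAlgebra (0 : QuadraticForm ℂ (I →₀ ℂ)), inferInstance, inferInstance, cr, an, 1,
      one_ne_zero, h0, by simpa [Stat.sign] using h1, by simpa [Stat.sign] using h2,
      by simpa [Stat.sign] using h3⟩

/-- Conjugate pairs of fields with (anti)commutation relations exist on a space with a nonzero
vacuum. -/
theorem exists_conjugate_fields.{u} (s : Stat) (I : Type u) [DecidableEq I] (c : ℂ) :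
    ∃ (M : Type u) (_ : AddCommGroup M) (_ : Module ℂ M) (P Φ : I → ℤ → Module.End ℂ M) (Ω : M),
      Ω ≠ 0 ∧ (∀ i, ∀ n ≤ 0, P i n Ω = 0) ∧ (∀ i, ∀ n < 0, Φ i n Ω = 0) ∧
      (∀ i j m n, P i m * P j n = s.sign • (P j n * P i m)) ∧
      (∀ i j m n, Φ i m * Φ j n = s.sign • (Φ j n * Φ i m)) ∧
      (∀ i j m n, P i m * Φ j n = s.sign • (Φ j n * P i m) +
        (if i = j ∧ m + n = 0 then c else 0) • 1) := by
  obtain ⟨M, _, _, cr, an, Ω, hΩ, h0, h1, h2, h3⟩ := exists_oscillators s (I × ℤ)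
  have hs := s.sign_mul_sign
  have h4 : ∀ i j, cr j * an i = s.sign • (an i * cr j) +
      (-s.sign * if i = j then 1 else 0 : ℂ) • 1 := fun i j => by
    rw [h3, smul_add, smul_smul, hs, smul_smul]
    module
  -- Oscillators with label `≥ 0` are the quanta of `Φ`, those with label `< 0` the quanta of `P`.
  -- The factor `-s.sign * c` compensates for the reversed order when `P` creates and `Φ`
  -- annihilates. Two modes of the same field, one creating and one annihilating, have labels of
  -- opposite kind and so never contract.
  refine ⟨M, _, _, fun i n => if 0 < n then cr (i, -n) else c • an (i, -n),
    fun i n => if 0 ≤ n then cr (i, n) else (-s.sign * c) • an (i, n), Ω, hΩ, fun i n hn => ?_,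
    fun i n hn => ?_, fun i j m n => ?_, fun i j m n => ?_, fun i j m n => ?_⟩
  · simp only [if_neg (not_lt.2 hn), LinearMap.smul_apply, h0, smul_zero]
  · simp only [if_neg (not_le.2 hn), LinearMap.smul_apply, h0, smul_zero]
  · dsimp only
    split_ifs with ha hb hb
    · rw [h1]
    · rw [mul_smul_comm, h4, if_neg (fun h => by injection h; omega), smul_mul_assoc]
      module
    · rw [smul_mul_assoc, h3, if_neg (fun h => by injection h; omega), mul_smul_comm]
      module
    · rw [smul_mul_assoc, mul_smul_comm, h2, smul_mul_assoc, mul_smul_comm]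
      module
  · dsimp only
    split_ifs with ha hb hb
    · rw [h1]
    · rw [mul_smul_comm, h4, if_neg (fun h => by injection h; omega), smul_mul_assoc]
      module
    · rw [smul_mul_assoc, h3, if_neg (fun h => by injection h; omega), mul_smul_comm]
      module
    · rw [smul_mul_assoc, mul_smul_comm, h2, smul_mul_assoc, mul_smul_comm]
      module
  · have hij : ((i, -m) = (j, n)) ↔ (i = j ∧ m + n = 0) := by
      rw [Prod.mk.injEq]
      exact and_congr_right fun _ => ⟨fun h => by omega, fun h => by omega⟩
    have hji : ((j, n) = (i, -m)) ↔ (i = j ∧ m + n = 0) := by rw [eq_comm, hij]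
    dsimp only
    by_cases ha : 0 < m <;> by_cases hb : 0 ≤ n
    · rw [if_pos ha, if_pos hb, if_neg (fun h => by omega), h1, zero_smul, add_zero]
    · rw [if_pos ha, if_neg hb, mul_smul_comm, smul_mul_assoc, h4]
      simp only [hji]
      split_ifs
      · have hc : (-s.sign * c) * (-s.sign * 1) = c := by linear_combination c * hs
        rw [smul_add, smul_smul _ _ (1 : Module.End ℂ M), hc]
        module
      · module
    · rw [if_neg ha, if_pos hb, mul_smul_comm, smul_mul_assoc, h3]
      simp only [hij]
      split_ifs <;> module
    · rw [if_neg ha, if_neg hb, if_neg (fun h => by omega), smul_mul_assoc, mul_smul_comm, h2,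
        smul_mul_assoc, mul_smul_comm]
      module

end Oscillators

/-! ### The vacuum is non-zero -/

section Vacuum

open TensorProduct

theorem tmul_ne_zero {V W : Type*} [AddCommGroup V] [Module ℂ V] [AddCommGroup W] [Module ℂ W]
    {v : V} {w : W} (hv : v ≠ 0) (hw : w ≠ 0) : v ⊗ₜ[ℂ] w ≠ 0 := by
  obtain ⟨f, hf⟩ := not_forall.1 (mt (Module.forall_dual_apply_eq_zero_iff ℂ v).1 hv)
  obtain ⟨g, hg⟩ := not_forall.1 (mt (Module.forall_dual_apply_eq_zero_iff ℂ w).1 hw)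
  intro h
  have := congrArg (TensorProduct.lid ℂ ℂ ∘ TensorProduct.map f g) h
  simp only [Function.comp_apply, TensorProduct.map_tmul, TensorProduct.lid_tmul, map_zero,
    smul_eq_mul] at this
  exact mul_ne_zero hf hg this

/-- A quotient by relations might collapse. It does not, because the enveloping algebra acts on the
tensor product of a bosonic model for the trajectory and a model for the matter fields, and there
the vacuum ideal kills `Ω ⊗ Ψ` while `1` does not. Trajectory and matter modes commute since they
act on different factors. -/
theorem vac_ne_zero.{u} (s : Stat) {N p : ℕ} {ι : Type u} [DecidableEq ι] :
    (vac s : Fock s N p ι) ≠ 0 := by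
  obtain ⟨V, _, _, P, Q, Ω, hΩ, hP, hQ, hPP, hQQ, hPQ⟩ :=
    exists_conjugate_fields .boson (Fin N) (1 / (2 * (Real.pi : ℂ)))
  obtain ⟨W, _, _, Λ, Φ, Ψ, hΨ, hΛ, hΦ, hΛΛ, hΦΦ, hΛΦ⟩ :=
    exists_conjugate_fields s (Comp N p ι) (1 / (2 * (Real.pi : ℂ)))
  have hs := s.sign_mul_sign
  simp only [Stat.sign, one_smul] at hPP hQQ hPQ
  have hQP : ∀ i j m n, Q i m * P j n = P j n * Q i m +
      (if j = i ∧ n + m = 0 then -(1 / (2 * (Real.pi : ℂ))) else 0) • 1 := fun i j m n => by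
    rw [hPQ]
    split_ifs <;> module
  have hΦΛ : ∀ i j m n, Φ i m * Λ j n = s.sign • (Λ j n * Φ i m) +
      (if j = i ∧ n + m = 0 then -s.sign * (1 / (2 * (Real.pi : ℂ))) else 0) • 1 :=
    fun i j m n => by
    rw [hΛΦ, smul_add, smul_smul, hs]
    split_ifs <;> module
  let r : Mode N p ι → Module.End ℂ (V ⊗[ℂ] W) := fun x => match x with
    | .q μ n => TensorProduct.map (Q μ n) 1
    | .p μ n => TensorProduct.map (P μ n) 1
    | .phi A n => TensorProduct.map 1 (Φ A n)
    | .mom A n => TensorProduct.map 1 (Λ A n)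
  have hr : ∀ x y, r x * r y = exch s x y • (r y * r x) + pairing s x y • 1 := by
    intro x y
    cases x <;> cases y <;>
      simp only [r, exch, pairing, ← TensorProduct.map_mul, Mode.isMatter, Bool.and_self,
        Bool.and_true, Bool.and_false, Bool.false_eq_true, if_false, if_true, one_mul, mul_one,
        one_smul, zero_smul, add_zero]
    · rw [hQQ]
    · rw [hQP, TensorProduct.map_add_left, TensorProduct.map_smul_left, TensorProduct.map_one]
    · rw [hPQ, TensorProduct.map_add_left, TensorProduct.map_smul_left, TensorProduct.map_one]
    · rw [hPP]
    · rw [hΦΦ, TensorProduct.map_smul_right]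
    · rw [hΦΛ, TensorProduct.map_add_right, TensorProduct.map_smul_right,
        TensorProduct.map_smul_right, TensorProduct.map_one]
    · rw [hΛΦ, TensorProduct.map_add_right, TensorProduct.map_smul_right,
        TensorProduct.map_smul_right, TensorProduct.map_one]
    · rw [hΛΛ, TensorProduct.map_smul_right]
  have hrel : ∀ ⦃a b⦄, HeisRel s a b → FreeAlgebra.lift ℂ r a = FreeAlgebra.lift ℂ r b := by
    rintro _ _ ⟨x, y⟩
    simp only [map_mul, map_add, map_smul, FreeAlgebra.lift_ι_apply, AlgHom.commutes]
    rw [Algebra.algebraMap_eq_smul_one]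
    exact hr x y
  let R : Heis s N p ι →ₐ[ℂ] Module.End ℂ (V ⊗[ℂ] W) := RingQuot.liftAlgHom ℂ ⟨_, hrel⟩
  have hR : ∀ x, R (gen s x) = r x := fun x => by
    refine (RingQuot.liftAlgHom_mkAlgHom_apply ℂ _ hrel _).trans ?_
    rw [FreeAlgebra.lift_ι_apply]
  intro h
  have h1 : (1 : Heis s N p ι) ∈ vacIdeal s N p ι :=
    (Submodule.Quotient.mk_eq_zero (vacIdeal s N p ι)).1 h
  have h2 : ∀ a ∈ vacIdeal s N p ι, R a (Ω ⊗ₜ Ψ) = 0 := fun a ha => by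
    refine Submodule.span_induction (p := fun a _ => R a (Ω ⊗ₜ Ψ) = 0) ?_ ?_ ?_ ?_ ha
    · rintro _ ⟨x, hx, rfl⟩
      rw [hR]
      cases x <;> simp only [Mode.Annihilates] at hx <;> simp [r, hP, hQ, hΛ, hΦ, hx]
    · simp
    · intro a b _ _ h1 h2
      rw [map_add, LinearMap.add_apply, h1, h2, add_zero]
    · intro a b _ h1
      rw [smul_eq_mul, map_mul, Module.End.mul_apply, h1, map_zero]
  have h3 := h2 1 h1
  rw [map_one, Module.End.one_apply] at h3
  exact tmul_ne_zero hΩ hΨ h3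

end Vacuum

/-! ### Frequency and charge, separation from the vacuum, and the lower bound on the energy -/

section Grading

variable {N p : ℕ} {ι : Type*}

theorem Mode.freq_nonneg {x : Mode N p ι} (hx : ¬ x.Annihilates) : 0 ≤ x.freq := by
  cases x <;> simp only [Mode.Annihilates, Mode.freq] at hx ⊢ <;> omega

variable [DecidableEq ι] (s : Stat)

theorem op_op_apply (x y : Mode N p ι) (v : Fock s N p ι) :
    op s x (op s y v) = exch s x y • op s y (op s x v) + pairing s x y • v :=
  congrArg (fun T : Module.End ℂ (Fock s N p ι) => T v) (op_mul_op s x y)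

theorem pairing_eq_zero_of_charge {x y : Mode N p ι} (h : x.charge + y.charge ≠ 0) :
    pairing s x y = 0 := by
  cases x <;> cases y <;> simp [Mode.charge, pairing] at h ⊢

/-- The span of the states of frequency `f` and charge `k` created from the vacuum. -/
noncomputable def graded (f k : ℤ) : Submodule ℂ (Fock s N p ι) :=
  Submodule.span ℂ {v | ∃ l : List (Mode N p ι), (∀ x ∈ l, ¬ x.Annihilates) ∧
    (l.map Mode.freq).sum = f ∧ (l.map Mode.charge).sum = k ∧ v = (l.map (op s)).prod (vac s)}

theorem word_mem_graded {l : List (Mode N p ι)} (hl : ∀ x ∈ l, ¬ x.Annihilates) {f k : ℤ}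
    (hf : (l.map Mode.freq).sum = f) (hk : (l.map Mode.charge).sum = k) :
    (l.map (op s)).prod (vac s) ∈ graded s f k :=
  Submodule.subset_span ⟨l, hl, hf, hk, rfl⟩

theorem vac_mem_graded : (vac s : Fock s N p ι) ∈ graded s 0 0 :=
  word_mem_graded s (l := []) (by simp) rfl rfl

theorem create_mem_graded {x : Mode N p ι} (hx : ¬ x.Annihilates) {f k : ℤ} {v : Fock s N p ι}
    (hv : v ∈ graded s f k) : op s x v ∈ graded s (x.freq + f) (x.charge + k) := by
  have h : graded s f k ≤ (graded s (x.freq + f) (x.charge + k)).comap (op s x) :=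
    Submodule.span_le.2 fun _ ⟨l, hl, hf, hk, hv⟩ => by
      subst hv
      refine word_mem_graded s (l := x :: l) ?_ (by simp [hf]) (by simp [hk])
      rintro y (_ | ⟨_, hy⟩)
      exacts [hx, hl y hy]
  exact h hv

/-- An annihilator is moved to the right through a word of creators until it meets the vacuum. A
contraction on the way removes two modes of opposite frequency and opposite charge, so all terms
have the expected degrees. -/
theorem op_mem_graded (x : Mode N p ι) {f k : ℤ} {v : Fock s N p ι}
    (hv : v ∈ graded s f k) : op s x v ∈ graded s (x.freq + f) (x.charge + k) := by
  by_cases hx : x.Annihilates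
  · have h : graded s f k ≤ (graded s (x.freq + f) (x.charge + k)).comap (op s x) := by
      refine Submodule.span_le.2 ?_
      rintro _ ⟨l, hl, rfl, rfl, rfl⟩
      change op s x _ ∈ graded s _ _
      clear hv
      induction l with
      | nil => simp [op_vac s hx]
      | cons y l ih =>
        have hl' : ∀ z ∈ l, ¬ z.Annihilates := fun z hz => hl z (List.mem_cons_of_mem _ hz)
        have h1 := create_mem_graded s (hl y List.mem_cons_self) (ih hl')
        simp only [List.map_cons, List.prod_cons, List.sum_cons, Module.End.mul_apply]
        rw [op_op_apply]
        refine Submodule.add_mem _ (Submodule.smul_mem _ _ ?_) ?_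
        · convert h1 using 2 <;> ring
        · by_cases h0 : pairing s x y = 0
          · rw [h0, zero_smul]
            exact Submodule.zero_mem _
          · have hf : x.freq + y.freq = 0 := by
              by_contra h
              exact h0 (pairing_eq_zero s h)
            have hk : x.charge + y.charge = 0 := by
              by_contra h
              exact h0 (pairing_eq_zero_of_charge s h)
            exact Submodule.smul_mem _ _ (word_mem_graded s hl' (by omega) (by omega))
    exact h hv
  · exact create_mem_graded s hx hv

theorem graded_eq_bot {f : ℤ} (hf : f < 0) (k : ℤ) :
    (graded s f k : Submodule ℂ (Fock s N p ι)) = ⊥ := by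
  refine Submodule.span_eq_bot.2 ?_
  rintro _ ⟨l, hl, hf', -, -⟩
  have : 0 ≤ (l.map Mode.freq).sum := List.sum_nonneg fun n hn => by
    obtain ⟨x, hx, rfl⟩ := List.mem_map.1 hn
    exact Mode.freq_nonneg (hl x hx)
  omega

/-- The states of charge `k`. -/
noncomputable def charged (k : ℤ) : Submodule ℂ (Fock s N p ι) := ⨆ f, graded s f k

theorem vac_mem_charged : (vac s : Fock s N p ι) ∈ charged s 0 :=
  le_iSup (fun f => graded s f 0) 0 (vac_mem_graded s)

/-- The operator raises the charge by `k`. -/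
def RaisesCharge (T : Module.End ℂ (Fock s N p ι)) (k : ℤ) : Prop :=
  ∀ j, ∀ v ∈ charged s j, T v ∈ charged s (j + k)

variable {s}

theorem raisesCharge_op (x : Mode N p ι) : RaisesCharge s (op s x) x.charge := by
  intro j v hv
  have h : charged s j ≤ (charged s (j + x.charge)).comap (op s x) :=
    iSup_le fun f u hu => by
      rw [add_comm]
      exact le_iSup (fun f => graded s f (x.charge + j)) _ (op_mem_graded s x hu)
  exact h hv

theorem RaisesCharge.mul {S T : Module.End ℂ (Fock s N p ι)} {k l n : ℤ} (hS : RaisesCharge s S k)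
    (hT : RaisesCharge s T l) (h : k + l = n) : RaisesCharge s (S * T) n := fun j v hv => by
  have := hS _ _ (hT j v hv)
  rwa [add_assoc, add_comm l, h] at this

theorem RaisesCharge.add {S T : Module.End ℂ (Fock s N p ι)} {k : ℤ} (hS : RaisesCharge s S k)
    (hT : RaisesCharge s T k) : RaisesCharge s (S + T) k :=
  fun j v hv => Submodule.add_mem _ (hS j v hv) (hT j v hv)

theorem RaisesCharge.smul {T : Module.End ℂ (Fock s N p ι)} {k : ℤ} (hT : RaisesCharge s T k)
    (c : ℂ) : RaisesCharge s (c • T) k :=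
  fun j v hv => Submodule.smul_mem _ c (hT j v hv)

theorem RaisesCharge.neg {T : Module.End ℂ (Fock s N p ι)} {k : ℤ} (hT : RaisesCharge s T k) :
    RaisesCharge s (-T) k :=
  fun j v hv => Submodule.neg_mem _ (hT j v hv)

theorem raisesCharge_zero (k : ℤ) : RaisesCharge s (0 : Module.End ℂ (Fock s N p ι)) k :=
  fun _ _ _ => Submodule.zero_mem _

theorem raisesCharge_one : RaisesCharge s (1 : Module.End ℂ (Fock s N p ι)) 0 :=
  fun j v hv => by rwa [add_zero]

theorem raisesCharge_sum {I : Type*} (S : Finset I) {T : I → Module.End ℂ (Fock s N p ι)} {k : ℤ}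
    (hT : ∀ i, RaisesCharge s (T i) k) : RaisesCharge s (∑ i ∈ S, T i) k :=
  Finset.sum_induction _ (RaisesCharge s · k) (fun _ _ h1 h2 => h1.add h2) (raisesCharge_zero k)
    fun i _ => hT i

theorem raisesCharge_lsum {I : Type*} {T : I → Module.End ℂ (Fock s N p ι)} {k : ℤ}
    (hT : ∀ i, RaisesCharge s (T i) k) : RaisesCharge s (lsum T) k := by
  by_cases h : LocFin T
  · intro j v hv
    rw [lsum_apply h]
    exact finsum_induction (· ∈ charged s (j + k)) (Submodule.zero_mem _)
      (fun _ _ => Submodule.add_mem _) fun i => hT i j v hv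
  -- Without local finiteness `lsum` takes its default value `0`, which raises the charge by any
  -- amount.
  · have : lsum T = 0 := dif_neg h
    rw [this]
    exact raisesCharge_zero k

theorem raisesCharge_tderiv {a : ℤ → Module.End ℂ (Fock s N p ι)} {k : ℤ}
    (ha : ∀ n, RaisesCharge s (a n) k) (n : ℤ) : RaisesCharge s (tderiv a n) k :=
  (ha n).smul _

theorem raisesCharge_fone (n : ℤ) :
    RaisesCharge s (fone n : Module.End ℂ (Fock s N p ι)) 0 := by
  unfold fone
  split_ifs
  exacts [raisesCharge_one, raisesCharge_zero 0]

theorem raisesCharge_fmul {a b : ℤ → Module.End ℂ (Fock s N p ι)}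
    (ha : ∀ n, RaisesCharge s (a n) 0) (hb : ∀ n, RaisesCharge s (b n) 0) (n : ℤ) :
    RaisesCharge s (fmul a b n) 0 :=
  raisesCharge_lsum fun j => (ha _).mul (hb j) rfl

theorem raisesCharge_normOrd {σ : ℂ} {P Φ : ℤ → Module.End ℂ (Fock s N p ι)} {k : ℤ}
    (hP : ∀ n, RaisesCharge s (P n) (-k)) (hΦ : ∀ n, RaisesCharge s (Φ n) k) (n : ℤ) :
    RaisesCharge s (normOrd σ P Φ n) 0 :=
  raisesCharge_lsum fun j => by
    split_ifs
    · exact (hP _).mul (hΦ _) (by ring)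
    · exact ((hΦ _).mul (hP _) (by ring)).smul σ

theorem raisesCharge_obsWord (l : List (ℕ × Fin N)) (n : ℤ) :
    RaisesCharge s (obsWord s l n : Module.End ℂ (Fock s N p ι)) 0 := by
  induction l generalizing n with
  | nil => exact raisesCharge_fone n
  | cons x l ih =>
    refine raisesCharge_fmul (fun n => ?_) ih n
    have : ∀ k : ℕ, ∀ n, RaisesCharge s
        (tderiv^[k] (qF s x.2) n : Module.End ℂ (Fock s N p ι)) 0 := fun k => by
      induction k with
      | zero => exact fun n => raisesCharge_op (.q x.2 n)
      | succ k ih =>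
        rw [Function.iterate_succ_apply']
        exact raisesCharge_tderiv ih
    exact this x.1 n

theorem raisesCharge_polyF (f : MvPolynomial (Fin N) ℂ) (n : ℤ) :
    RaisesCharge s (polyF s f n : Module.End ℂ (Fock s N p ι)) 0 :=
  raisesCharge_sum _ fun _ => (raisesCharge_obsWord _ n).smul _

theorem raisesCharge_normOrd_momF {A B : Comp N p ι} {σ : ℂ} (n : ℤ) :
    RaisesCharge s (normOrd σ (momF s A) (phiF s B) n) 0 :=
  raisesCharge_normOrd (k := 1) (fun n => raisesCharge_op (.mom A n))
    (fun n => raisesCharge_op (.phi B n)) n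

variable [Fintype ι]

theorem raisesCharge_lieOp (ρ : Matrix (Fin N) (Fin N) ℂ →ₗ[ℂ] Matrix ι ι ℂ)
    (ξ : Fin N → MvPolynomial (Fin N) ℂ) :
    RaisesCharge s (lieOp s ρ ξ : Module.End ℂ (Fock s N p ι)) 0 := by
  refine RaisesCharge.smul (.add (raisesCharge_sum _ fun μ => ?_)
    (.smul (raisesCharge_sum _ fun n => raisesCharge_sum _ fun m => ?_) _)) _
  · exact raisesCharge_normOrd (k := 0) (fun n => raisesCharge_op (.p μ n))
      (raisesCharge_polyF (ξ μ)) 0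
  · split_ifs
    · exact raisesCharge_sum _ fun β => raisesCharge_sum _ fun α =>
        raisesCharge_fmul (raisesCharge_polyF _) raisesCharge_normOrd_momF 0
    · exact raisesCharge_zero 0

theorem raisesCharge_repar (lam w : ℂ) (m : ℤ) :
    RaisesCharge s (repar s N p ι lam w m) 0 := by
  refine RaisesCharge.smul (.add (.add (raisesCharge_sum _ fun μ => ?_).neg
    (.smul (raisesCharge_sum _ fun A => ?_) _)) ((raisesCharge_fone m).smul _)) _
  · exact raisesCharge_normOrd (k := 0) (fun n => raisesCharge_op (.p μ n))
      (raisesCharge_tderiv fun n => raisesCharge_op (.q μ n)) m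
  · exact .add (.add (raisesCharge_normOrd (k := 1) (fun n => raisesCharge_op (.mom A n))
      (raisesCharge_tderiv fun n => raisesCharge_op (.phi A n)) m).neg
      ((raisesCharge_tderiv raisesCharge_normOrd_momF m).smul _))
      ((raisesCharge_normOrd_momF m).smul _)

/-- In every generator the matter fields occur only in pairs `π φ`, or not at all. -/
theorem raisesCharge_of_mem_droAlg {ρ : Matrix (Fin N) (Fin N) ℂ →ₗ[ℂ] Matrix ι ι ℂ} {lam w : ℂ}
    {T : Module.End ℂ (Fock s N p ι)} (hT : T ∈ droAlg s ρ p lam w) : RaisesCharge s T 0 := by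
  induction hT using Algebra.adjoin_induction with
  | mem T hT =>
    obtain (⟨ξ, rfl⟩ | ⟨m, rfl⟩) | ⟨x, rfl⟩ := hT
    · exact raisesCharge_lieOp ρ ξ
    · exact raisesCharge_repar lam w m
    · exact raisesCharge_obsWord x.1 x.2
  | algebraMap r =>
    rw [Algebra.algebraMap_eq_smul_one]
    exact raisesCharge_one.smul r
  | add _ _ _ _ h1 h2 => exact h1.add h2
  | mul _ _ _ _ h1 h2 => exact h1.mul h2 rfl

variable (s)

theorem hasEnergy_vac (lam w : ℂ) :
    HasEnergy s lam w (vac s : Fock s N p ι) (lowestEnergy s N p (Fintype.card ι) lam w) := by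
  have := repar_vac (N := N) (p := p) (ι := ι) s lam w (m := 0) le_rfl
  rwa [if_pos rfl] at this

variable {s}

theorem HasEnergy.congr {lam w E E' : ℂ} {v : Fock s N p ι} (h : HasEnergy s lam w v E)
    (hE : E = E') : HasEnergy s lam w v E' := hE ▸ h

theorem HasEnergy.op {lam w E : ℂ} {v : Fock s N p ι} (h : HasEnergy s lam w v E)
    (x : Mode N p ι) : HasEnergy s lam w (op s x v) (E + (x.freq + w * x.charge)) := by
  have h1 : ham s N p ι lam w (DRO.op s x v) = DRO.op s x (ham s N p ι lam w v) + _ :=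
    congrArg (fun T : Module.End ℂ (Fock s N p ι) => T v) (ham_mul_op s lam w x)
  unfold HasEnergy at h ⊢
  rw [h1, h, map_smul, add_smul E]
  rfl

/-- The grading does not depend on `lam` and `w`, so one graded space consists of eigenvectors of
the Hamiltonians for all parameters at once. -/
theorem graded_le_eigenspace (lam w : ℂ) (f k : ℤ) :
    (graded s f k : Submodule ℂ (Fock s N p ι)) ≤ (ham s N p ι lam w).eigenspace
      (lowestEnergy s N p (Fintype.card ι) lam w + (f + w * k)) := by
  refine Submodule.span_le.2 ?_
  rintro _ ⟨l, -, rfl, rfl, rfl⟩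
  rw [SetLike.mem_coe, Module.End.mem_eigenspace_iff]
  change HasEnergy s lam w _ _
  induction l with
  | nil => simpa using hasEnergy_vac (N := N) (p := p) (ι := ι) s lam w
  | cons x l ih =>
    refine (ih.op x).congr ?_
    simp only [List.map_cons, List.sum_cons, Int.cast_add]
    ring

/-- The difference of the Hamiltonians at `w = 1` and `w = 0` is a charge operator: the frequency
cancels, and it acts on charge `k` as the scalar `c + k`. This makes linear independence of the
words unnecessary. -/
theorem eq_zero_of_mem_charged {j k : ℤ} (hjk : j ≠ k) {v : Fock s N p ι} (hj : v ∈ charged s j)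
    (hk : v ∈ charged s k) : v = 0 := by
  set Q := ham s N p ι 0 1 - ham s N p ι 0 0
  set c := lowestEnergy s N p (Fintype.card ι) 0 1 - lowestEnergy s N p (Fintype.card ι) 0 0
  have h : ∀ k : ℤ, ∀ v ∈ (charged s k : Submodule ℂ (Fock s N p ι)), Q v = (c + k) • v := by
    intro k v hv
    have hle : charged s k ≤ Q.eigenspace (c + k) := iSup_le fun f u hu => by
      have h1 := Module.End.mem_eigenspace_iff.1 (graded_le_eigenspace 0 1 f k hu)
      have h0 := Module.End.mem_eigenspace_iff.1 (graded_le_eigenspace 0 0 f k hu)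
      rw [Module.End.mem_eigenspace_iff, LinearMap.sub_apply, h1, h0, ← sub_smul]
      congr 1
      simp only [c]
      ring
    exact Module.End.mem_eigenspace_iff.1 (hle hv)
  have h1 : ((j : ℂ) - k) • v = 0 := by
    have := (h j v hj).symm.trans (h k v hk)
    rw [← sub_eq_zero, ← sub_smul] at this
    rwa [add_sub_add_left_eq_sub] at this
  refine (smul_eq_zero.1 h1).resolve_left ?_
  refine sub_ne_zero.2 ?_
  exact_mod_cast hjk

theorem mem_charged_of_mem_span {ρ : Matrix (Fin N) (Fin N) ℂ →ₗ[ℂ] Matrix ι ι ℂ} {lam w : ℂ}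
    {k : ℤ} {u v : Fock s N p ι} (hv : v ∈ charged s k)
    (hu : u ∈ Submodule.span (droAlg s ρ p lam w) {v}) : u ∈ charged s k := by
  obtain ⟨T, rfl⟩ := Submodule.mem_span_singleton.1 hu
  have := raisesCharge_of_mem_droAlg T.2 k v hv
  rwa [add_zero] at this

/-- The submodule generated by a vector of definite charge stays in that charge, and here the two
charges `k` and `0` differ. -/
theorem separatedFromVacuum {ρ : Matrix (Fin N) (Fin N) ℂ →ₗ[ℂ] Matrix ι ι ℂ} {lam w : ℂ}
    {k : ℤ} (hk : k ≠ 0) {v : Fock s N p ι} (hv : v ∈ charged s k) (h0 : v ≠ 0) :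
    SeparatedFromVacuum s ρ lam w v :=
  ⟨fun h => vac_ne_zero s
    (eq_zero_of_mem_charged hk (mem_charged_of_mem_span hv h) (vac_mem_charged s)),
   fun h => h0 (eq_zero_of_mem_charged hk hv (mem_charged_of_mem_span (vac_mem_charged s) h))⟩

/-- The states of charge zero lie in the sum of the eigenspaces of `h + f` with `f ≥ 0`, and
eigenspaces are independent. Charge zero is essential: otherwise `w` times the charge enters, and `h
- r` could be an eigenvalue. -/
theorem eq_zero_of_lt_lowestEnergy {lam w : ℂ} {v : Fock s N p ι} (hv : v ∈ charged s 0) {r : ℝ}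
    (hr : 0 < r)
    (hE : HasEnergy s lam w v (lowestEnergy s N p (Fintype.card ι) lam w - r)) : v = 0 := by
  set h := lowestEnergy s N p (Fintype.card ι) lam w
  have hind := Module.End.eigenspaces_iSupIndep (ham s N p ι lam w) (h - r)
  refine (Submodule.mem_bot ℂ).1 (hind.le_bot ⟨Module.End.mem_eigenspace_iff.2 hE, ?_⟩)
  have hle : (charged s 0 : Submodule ℂ (Fock s N p ι)) ≤
      ⨆ j, ⨆ (_ : j ≠ h - r), (ham s N p ι lam w).eigenspace j := iSup_le fun f => by
    rcases lt_or_ge f 0 with hf | hf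
    · rw [graded_eq_bot s hf]
      exact bot_le
    · refine (graded_le_eigenspace lam w f 0).trans (le_iSup₂_of_le _ ?_ le_rfl)
      intro he
      have h1 : (f : ℂ) = ((-r : ℝ) : ℂ) := by
        push_cast at he ⊢
        linear_combination he
      have h2 : (f : ℝ) = -r := by exact_mod_cast h1
      have h3 : (0 : ℝ) ≤ f := by exact_mod_cast hf
      linarith
  exact hle hv

theorem apply_vac_eq_zero {ρ : Matrix (Fin N) (Fin N) ℂ →ₗ[ℂ] Matrix ι ι ℂ} {lam w : ℂ}
    {T : Module.End ℂ (Fock s N p ι)} (hT : T ∈ droAlg s ρ p lam w) {r : ℝ} (hr : 0 < r)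
    (h : ham s N p ι lam w * T - T * ham s N p ι lam w = (-(r : ℂ)) • T) : T (vac s) = 0 := by
  refine eq_zero_of_lt_lowestEnergy (lam := lam) (w := w)
    (raisesCharge_of_mem_droAlg hT 0 _ (vac_mem_charged s)) hr ?_
  have h1 := congrArg (fun S : Module.End ℂ (Fock s N p ι) => S (vac s)) h
  simp only [LinearMap.sub_apply, Module.End.mul_apply, LinearMap.smul_apply] at h1
  have h2 : ham s N p ι lam w (vac s) = _ := hasEnergy_vac s lam w
  rw [h2, map_smul, sub_eq_iff_eq_add] at h1
  unfold HasEnergy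
  rw [h1, ← add_smul]
  congr 1
  ring

end Grading

/-! ### Cyclic states: bosonic powers and filled fermionic levels -/

section CyclicStates

theorem two_pi_inv_ne_zero : 1 / (2 * (Real.pi : ℂ)) ≠ 0 :=
  one_div_ne_zero (mul_ne_zero two_ne_zero (Complex.ofReal_ne_zero.2 Real.pi_ne_zero))


variable {N p : ℕ} {ι : Type*} [DecidableEq ι]

/-- A family of anticommuting modes `X_A(n)` together with the conjugate modes `Y_A(n)`; those of
frequency at least `a`, respectively `1 - a`, create states from the vacuum. -/
structure ConjugateModes (X Y : Comp N p ι → ℤ → Mode N p ι) (a c : ℤ) : Prop where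
  exch_self : ∀ A B m n, exch .fermion (X A m) (X B n) = -1
  pairing_self : ∀ A B m n, pairing .fermion (X A m) (X B n) = 0
  pairing_ne_zero : ∀ A n, pairing .fermion (Y A (-n)) (X A n) ≠ 0
  pairing_eq_zero : ∀ A B m n, A ≠ B ∨ m ≠ n → pairing .fermion (Y A (-m)) (X B n) = 0
  shift : ∀ A m n, (X A n).shift m = X A (m + n)
  freq : ∀ A n, (X A n).freq = n
  charge : ∀ A n, (X A n).charge = c
  annihilates : ∀ A, ∀ n < a, (X A n).Annihilates
  annihilates_conj : ∀ A, ∀ n ≥ a, (Y A (-n)).Annihilates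

theorem conjugateModes_phi :
    ConjugateModes (N := N) (p := p) (ι := ι) Mode.phi Mode.mom 0 1 where
  exch_self _ _ _ _ := rfl
  pairing_self _ _ _ _ := rfl
  pairing_ne_zero A n := by simp [pairing]
  pairing_eq_zero A B m n h := if_neg (by
    rintro ⟨rfl, h2⟩
    exact h.elim (fun h => h rfl) fun h => h (by omega))
  shift _ _ _ := rfl
  freq _ _ := rfl
  charge _ _ := rfl
  annihilates A n hn := hn
  annihilates_conj A n hn := by simpa [Mode.Annihilates] using hn

/-- The creating levels start at `1`, because `π̂(0)` annihilates the vacuum. -/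
theorem conjugateModes_mom :
    ConjugateModes (N := N) (p := p) (ι := ι) Mode.mom Mode.phi 1 (-1) where
  exch_self _ _ _ _ := rfl
  pairing_self _ _ _ _ := rfl
  pairing_ne_zero A n := by simp [pairing, Stat.sign]
  pairing_eq_zero A B m n h := if_neg (by
    rintro ⟨rfl, h2⟩
    exact h.elim (fun h => h rfl) fun h => h (by omega))
  shift _ _ _ := rfl
  freq _ _ := rfl
  charge _ _ := rfl
  annihilates A n hn := Int.lt_add_one_iff.1 hn
  annihilates_conj A n hn := by
    simp only [Mode.Annihilates]
    omega

variable {s : Stat} [Fintype ι]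

theorem reparMode_apply_eq_zero_iff {lam w : ℂ} {m : ℤ} {v : Fock s N p ι} :
    reparMode s N p ι lam w m v = 0 ↔ repar s N p ι lam w m v = 0 := by
  have hpi : (Real.pi : ℂ) ≠ 0 := Complex.ofReal_ne_zero.2 Real.pi_ne_zero
  have hc : -Complex.I * (2 * (Real.pi : ℂ)) ≠ 0 :=
    mul_ne_zero (neg_ne_zero.2 Complex.I_ne_zero) (mul_ne_zero two_ne_zero hpi)
  unfold repar
  rw [LinearMap.smul_apply, smul_eq_zero, or_iff_right hc]

variable (s) in
theorem isCyclicState_vac (lam w : ℂ) : IsCyclicState s lam w (vac s : Fock s N p ι) :=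
  ⟨vac_ne_zero s, fun m hm => by
    rw [reparMode_apply_eq_zero_iff, repar_vac s lam w hm.le, if_neg hm.ne, zero_smul]⟩

/-- This is the induction step of all cyclicity proofs: commuting past `x` costs only the shifted
mode. -/
theorem reparMode_op_eq_zero {lam w : ℂ} {m : ℤ} {v : Fock s N p ι} {x : Mode N p ι}
    (hv : reparMode s N p ι lam w m v = 0) (hx : op s (x.shift m) v = 0) :
    reparMode s N p ι lam w m (op s x v) = 0 := by
  rw [reparMode_apply_eq_zero_iff] at hv ⊢
  have h : repar s N p ι lam w m (op s x v) = op s x (repar s N p ι lam w m v) +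
      x.reparCoeff lam w m • op s (x.shift m) v :=
    congrArg (fun T : Module.End ℂ (Fock s N p ι) => T v) (repar_mul_op s lam w m x)
  rw [h, hv, hx, map_zero, smul_zero, add_zero]

section Boson

variable (A : Comp N p ι)

/-- `π̂(0)` and `φ̂(0)` form an oscillator pair. Stripping off one factor with a non-zero
coefficient shows inductively that the powers do not vanish. -/
theorem momF_phiF_pow_vac (n : ℕ) :
    momF .boson A 0 ((phiF .boson A 0 ^ (n + 1)) (vac .boson)) =
      (((n : ℂ) + 1) * (1 / (2 * (Real.pi : ℂ)))) • (phiF .boson A 0 ^ n) (vac .boson) := by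
  have h : ∀ v, momF .boson A 0 (phiF .boson A 0 v) = phiF .boson A 0 (momF .boson A 0 v) +
      (1 / (2 * (Real.pi : ℂ))) • v := fun v => by
    unfold momF phiF
    rw [op_op_apply]
    simp [exch, Mode.isMatter, Stat.sign, pairing]
  induction n with
  | zero =>
    have h0 : momF .boson A 0 (vac .boson) = 0 := op_vac .boson (x := .mom A 0) le_rfl
    simp [h, h0]
  | succ n ih =>
    rw [pow_succ', Module.End.mul_apply, h, ih, map_smul, ← Module.End.mul_apply, ← pow_succ',
      ← add_smul]
    congr 1
    push_cast
    ring

theorem phiF_pow_vac_ne_zero (n : ℕ) : (phiF .boson A 0 ^ n) (vac .boson) ≠ 0 := by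
  induction n with
  | zero => exact vac_ne_zero .boson
  | succ n ih =>
    intro h
    have h1 := momF_phiF_pow_vac A n
    rw [h, map_zero, eq_comm, smul_eq_zero] at h1
    exact mul_ne_zero (Nat.cast_add_one_ne_zero n) two_pi_inv_ne_zero (h1.resolve_right ih)

theorem isCyclicState_phiF_pow_vac (lam w : ℂ) (n : ℕ) :
    IsCyclicState .boson lam w ((phiF .boson A 0 ^ n) (vac .boson)) := by
  refine ⟨phiF_pow_vac_ne_zero A n, fun m hm => ?_⟩
  have h : ∀ n : ℕ, op .boson (.phi A (m + 0)) ((phiF .boson A 0 ^ n) (vac .boson)) = 0 :=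
    fun n => by
    have hc : Commute (op .boson (.phi A (m + 0))) (phiF .boson A 0) := commute_op .boson rfl rfl
    rw [← Module.End.mul_apply, (hc.pow_right n).eq, Module.End.mul_apply,
      op_vac .boson (x := .phi A (m + 0)) (by simpa [Mode.Annihilates] using hm), map_zero]
  induction n with
  | zero => exact (isCyclicState_vac .boson lam w).2 m hm
  | succ n ih =>
    rw [pow_succ', Module.End.mul_apply]
    exact reparMode_op_eq_zero ih (h n)

theorem hasEnergy_phiF_pow_vac (lam w : ℂ) (n : ℕ) :
    HasEnergy .boson lam w ((phiF .boson A 0 ^ n) (vac .boson))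
      (lowestEnergy .boson N p (Fintype.card ι) lam w + n * w) := by
  induction n with
  | zero => simpa using hasEnergy_vac (N := N) (p := p) (ι := ι) .boson lam w
  | succ n ih =>
    rw [pow_succ', Module.End.mul_apply]
    refine (ih.op (.phi A 0)).congr ?_
    simp only [Mode.freq, Mode.charge]
    push_cast
    ring

theorem phiF_pow_vac_mem_charged (n : ℕ) :
    (phiF .boson A 0 ^ n) (vac .boson) ∈ charged .boson (n : ℤ) := by
  induction n with
  | zero => exact vac_mem_charged .boson
  | succ n ih =>
    rw [pow_succ', Module.End.mul_apply, Nat.cast_succ]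
    exact raisesCharge_op (.phi A 0) _ _ ih

end Boson

section Stacks

variable {X Y : Comp N p ι → ℤ → Mode N p ι} {a c : ℤ} {lam w : ℂ}

/-- The state is cyclic, and its occupied levels are those below `b` for all components in `o`, and
the level `b` for the components in `t`. -/
structure Filled (X Y : Comp N p ι → ℤ → Mode N p ι) (lam w : ℂ) (o t : List (Comp N p ι)) (b : ℤ)
    (v : Fock .fermion N p ι) : Prop where
  cyclic : IsCyclicState .fermion lam w v
  occupied : ∀ A ∈ o, ∀ j < b, op .fermion (X A j) v = 0
  occupied_top : ∀ A ∈ t, op .fermion (X A b) v = 0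
  empty : ∀ A, ∀ j > b, op .fermion (Y A (-j)) v = 0
  empty_top : ∀ A ∉ t, op .fermion (Y A (-b)) v = 0

theorem ConjugateModes.op_op (h : ConjugateModes X Y a c) (A B : Comp N p ι) (m n : ℤ)
    (v : Fock .fermion N p ι) :
    op .fermion (X A m) (op .fermion (X B n) v) = -op .fermion (X B n) (op .fermion (X A m) v) := by
  rw [op_op_apply, h.exch_self, h.pairing_self, zero_smul, add_zero, neg_smul, one_smul]

theorem ConjugateModes.op_op_self (h : ConjugateModes X Y a c) (A : Comp N p ι) (m : ℤ)
    (v : Fock .fermion N p ι) : op .fermion (X A m) (op .fermion (X A m) v) = 0 := by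
  have h2 := h.op_op A A m m v
  rw [eq_neg_iff_add_eq_zero, ← two_smul ℂ, smul_eq_zero] at h2
  exact h2.resolve_left two_ne_zero

/-- A mode of `L(t)` of negative frequency would lower `X A b` to a level below `b` of the same
component, which is occupied. The new state is non-zero because `Y A (-b)` kills `v` and so recovers
a non-zero multiple of `v` from it. -/
theorem Filled.op (h : ConjugateModes X Y a c) {o t : List (Comp N p ι)} {b : ℤ}
    {v : Fock .fermion N p ι} (hv : Filled X Y lam w o t b v) {A : Comp N p ι} (hA : A ∈ o)
    (hAt : A ∉ t) : Filled X Y lam w o (A :: t) b (op .fermion (X A b) v) where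
  cyclic := by
    refine ⟨fun h0 => ?_, fun m hm => reparMode_op_eq_zero (hv.cyclic.2 m hm) ?_⟩
    · have h1 := op_op_apply .fermion (Y A (-b)) (X A b) v
      rw [h0, hv.empty_top A hAt, map_zero, map_zero, smul_zero, zero_add, eq_comm,
        smul_eq_zero] at h1
      exact h1.elim (h.pairing_ne_zero A b) hv.cyclic.1
    · rw [h.shift]
      exact hv.occupied A hA _ (by omega)
  occupied B hB j hj := by rw [h.op_op, hv.occupied B hB j hj, map_zero, neg_zero]
  occupied_top B hB := by
    rcases List.mem_cons.1 hB with rfl | hB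
    · exact h.op_op_self _ _ _
    · rw [h.op_op, hv.occupied_top B hB, map_zero, neg_zero]
  empty B j hj := by
    rw [op_op_apply, hv.empty B j hj, h.pairing_eq_zero B A j b (.inr hj.ne'), map_zero,
      smul_zero, zero_smul, add_zero]
  empty_top B hB := by
    rw [List.mem_cons, not_or] at hB
    rw [op_op_apply, hv.empty_top B hB.2, h.pairing_eq_zero B A b b (.inl hB.1), map_zero,
      smul_zero, zero_smul, add_zero]

theorem Filled.list_prod (h : ConjugateModes X Y a c) {o : List (Comp N p ι)} {b : ℤ}
    {v : Fock .fermion N p ι} (hv : Filled X Y lam w o [] b v) {t : List (Comp N p ι)}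
    (ht : t.Nodup) (hto : t ⊆ o) :
    Filled X Y lam w o t b ((t.map fun A => DRO.op .fermion (X A b)).prod v) := by
  induction t with
  | nil => exact hv
  | cons A t ih =>
    rw [List.nodup_cons] at ht
    rw [List.cons_subset] at hto
    exact (ih ht.2 hto.2).op h hto.1 ht.1

theorem Filled.next {o : List (Comp N p ι)} {b : ℤ}
    {v : Fock .fermion N p ι} (hv : Filled X Y lam w o o b v) :
    Filled X Y lam w o [] (b + 1) v where
  cyclic := hv.cyclic
  occupied A hA j hj := by
    rcases (Int.lt_add_one_iff.1 hj).lt_or_eq with hj | rfl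
    exacts [hv.occupied A hA j hj, hv.occupied_top A hA]
  occupied_top A hA := by simp at hA
  empty A j hj := hv.empty A j (by omega)
  empty_top A _ := hv.empty A (b + 1) (by omega)

variable {F : ℤ → Module.End ℂ (Fock .fermion N p ι)} {o : List (Comp N p ι)}

/-- The vacuum is a Dirac sea: its levels below `a` count as occupied, those from `a` on as empty.
Each factor fills one further level for all components in `o`. -/
theorem filled_stack (h : ConjugateModes X Y a c) (ho : o.Nodup)
    (hF : ∀ n, F n = (o.map fun A => op .fermion (X A n)).prod) (k : ℕ) :
    Filled X Y lam w o [] (a + k) (stack .fermion F a k) := by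
  induction k with
  | zero =>
    rw [Nat.cast_zero, add_zero]
    exact ⟨isCyclicState_vac .fermion lam w,
      fun A _ j hj => op_vac .fermion (h.annihilates A j hj), fun A hA => by simp at hA,
      fun A j hj => op_vac .fermion (h.annihilates_conj A j hj.le),
      fun A _ => op_vac .fermion (h.annihilates_conj A a le_rfl)⟩
  | succ k ih =>
    rw [stack, hF, Nat.cast_succ, ← add_assoc]
    exact (ih.list_prod h ho (List.Subset.refl o)).next

theorem hasEnergy_list_prod (h : ConjugateModes X Y a c) {E : ℂ} {v : Fock .fermion N p ι}
    (hv : HasEnergy .fermion lam w v E) (o : List (Comp N p ι)) (n : ℤ) :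
    HasEnergy .fermion lam w ((o.map fun A => op .fermion (X A n)).prod v)
      (E + o.length * (n + w * c)) := by
  induction o with
  | nil => simpa using hv
  | cons A o ih =>
    rw [List.map_cons, List.prod_cons, Module.End.mul_apply]
    refine (ih.op (X A n)).congr ?_
    rw [h.freq, h.charge, List.length_cons]
    push_cast
    ring

/-- Level `a + j` costs `a + j + w * c` per component, and summing over `j < k` gives the quadratic
expression. -/
theorem hasEnergy_stack (h : ConjugateModes X Y a c)
    (hF : ∀ n, F n = (o.map fun A => op .fermion (X A n)).prod) (k : ℕ) :
    HasEnergy .fermion lam w (stack .fermion F a k)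
      (lowestEnergy .fermion N p (Fintype.card ι) lam w +
        1 / 2 * o.length * ((k : ℂ) ^ 2 + (2 * (w * c + a) - 1) * k)) := by
  induction k with
  | zero => simpa [stack] using hasEnergy_vac (N := N) (p := p) (ι := ι) .fermion lam w
  | succ k ih =>
    rw [stack, hF]
    refine (hasEnergy_list_prod h ih o (a + k)).congr ?_
    push_cast
    ring

theorem stack_mem_charged (h : ConjugateModes X Y a c)
    (hF : ∀ n, F n = (o.map fun A => op .fermion (X A n)).prod) (k : ℕ) :
    stack .fermion F a k ∈ charged .fermion (k * (o.length * c)) := by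
  have hl : ∀ (t : List (Comp N p ι)) (n : ℤ),
      RaisesCharge .fermion (t.map fun A => op .fermion (X A n)).prod (t.length * c) :=
    fun t n => by
      induction t with
      | nil => simpa using raisesCharge_one
      | cons A t ih =>
        refine (raisesCharge_op (X A n)).mul ih ?_
        rw [h.charge, List.length_cons]
        push_cast
        ring
  induction k with
  | zero => simpa [stack] using vac_mem_charged .fermion
  | succ k ih =>
    rw [stack, hF]
    convert hl o (a + k) _ _ ih using 2
    push_cast
    ring

theorem separatedFromVacuum_stack {ρ : Matrix (Fin N) (Fin N) ℂ →ₗ[ℂ] Matrix ι ι ℂ}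
    (h : ConjugateModes X Y a c) (hc : c ≠ 0) (ho : o.Nodup) (ho' : o ≠ [])
    (hF : ∀ n, F n = (o.map fun A => op .fermion (X A n)).prod) {k : ℕ} (hk : 1 ≤ k) :
    SeparatedFromVacuum .fermion ρ lam w (stack .fermion F a k) := by
  refine separatedFromVacuum ?_ (stack_mem_charged h hF k)
    (filled_stack (lam := lam) (w := w) h ho hF k).cyclic.1
  refine mul_ne_zero (by omega) (mul_ne_zero ?_ hc)
  exact_mod_cast (List.length_pos_iff.2 ho').ne'

theorem stack_momProd_zero_eq_zero {s : Stat} {o : List (Comp N p ι)} (ho : o ≠ []) {k : ℕ}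
    (hk : 1 ≤ k) : stack s (momProd s o) 0 k = 0 := by
  induction k, hk using Nat.le_induction with
  | base =>
    -- The last mode in the list acts first, and it already annihilates the vacuum.
    obtain ⟨t, A, rfl⟩ := (List.eq_nil_or_concat' o).resolve_left ho
    have h : momF s A 0 (vac s) = 0 := op_vac s (x := .mom A 0) le_rfl
    simp [stack, momProd, h]
  | succ k _ ih => rw [stack, ih, map_zero]

end Stacks

end CyclicStates

/-! ### Counting multi-indices -/

section Counting

variable {N p : ℕ}

/-- A slack variable `ℓ - |m|`, indexed by `none`, turns the inequality into an equation in `N + 1`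
variables with sum `ℓ`; then stars and bars applies. -/
theorem card_jetIdx_order_le {ℓ : ℕ} (hℓ : ℓ ≤ p) :
    (Finset.univ.filter fun m : JetIdx N p => m.order ≤ ℓ).card = (N + ℓ).choose ℓ := by
  have h := Finset.card_finsuppAntidiag_nat_eq_choose (s := (Finset.univ : Finset (Option (Fin N)))) ℓ
  rw [Finset.card_univ, Fintype.card_option, Fintype.card_fin,
    show N + 1 + ℓ - 1 = N + ℓ by omega] at h
  rw [← h]
  refine Finset.card_bij
    (fun m _ => Finsupp.equivFunOnFinite.symm fun o : Option (Fin N) => o.elim (ℓ - m.order) m.exps)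
    ?_ ?_ ?_
  · intro m hm
    rw [Finset.mem_filter] at hm
    simp only [Finset.mem_finsuppAntidiag, Finset.subset_univ, and_true,
      Finsupp.equivFunOnFinite_symm_apply_apply, Fintype.sum_option, Option.elim]
    exact Nat.sub_add_cancel hm.2
  · intro m _ m' _ he
    have he' := Finsupp.equivFunOnFinite.symm.injective he
    ext μ
    exact congrFun he' (some μ)
  · intro f hf
    simp only [Finset.mem_finsuppAntidiag, Finset.subset_univ, and_true, Fintype.sum_option] at hf
    have hle : ∀ μ, f (some μ) ≤ ℓ := fun μ =>
      (Finset.single_le_sum (f := fun μ => f (some μ)) (fun _ _ => Nat.zero_le _)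
        (Finset.mem_univ μ)).trans (by omega)
    have hs : ∑ μ, f (some μ) ≤ p := by omega
    let m : JetIdx N p := ⟨fun μ => ⟨f (some μ), Nat.lt_succ_of_le ((hle μ).trans hℓ)⟩, hs⟩
    have hm : m.order = ∑ μ, f (some μ) := rfl
    refine ⟨m, Finset.mem_filter.2 ⟨Finset.mem_univ m, by omega⟩, ?_⟩
    ext o
    cases o with
    | none =>
      change ℓ - m.order = f none
      omega
    | some μ => rfl

variable {ι : Type*} [Fintype ι]

theorem card_comp (P : JetIdx N p → Prop) [DecidablePred P] :
    (Finset.univ.filter fun A : Comp N p ι => P A.2).card =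
      Fintype.card ι * (Finset.univ.filter P).card := by
  rw [← Finset.card_univ (α := ι), ← Finset.card_product]
  congr 1
  ext A
  simp

theorem Enumerates.length_eq [DecidableEq ι] {o : List (Comp N p ι)} {P : JetIdx N p → Prop}
    [DecidablePred P] (ho : Enumerates o fun A => P A.2) :
    o.length = Fintype.card ι * (Finset.univ.filter P).card := by
  rw [← card_comp, ← List.toFinset_card_of_nodup ho.1]
  congr 1
  ext A
  simp [ho.2]

/-- The complement is `|m| ≤ ℓ - 1`. For `ℓ = 0` it is empty, whereas truncated subtraction would
make the binomial coefficient `1`. -/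
theorem card_jetIdx_le_order {ℓ : ℕ} (hℓ : ℓ ≤ p) :
    ((Finset.univ.filter fun m : JetIdx N p => ℓ ≤ m.order).card : ℂ) = ((N + p).choose p : ℂ) -
      (if ℓ = 0 then 0 else ((N + ℓ - 1).choose (ℓ - 1) : ℂ)) := by
  have hp : ∀ m : JetIdx N p, m.order ≤ p := fun m => m.2
  have h := Finset.card_filter_add_card_filter_not (s := (Finset.univ : Finset (JetIdx N p)))
    fun m => ℓ ≤ m.order
  have hu := card_jetIdx_order_le (N := N) (le_refl p)
  rw [Finset.filter_true_of_mem fun m _ => hp m] at hu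
  rw [hu] at h
  rw [eq_sub_iff_add_eq, ← h]
  push_cast
  congr 1
  rcases ℓ with _ | ℓ
  · simp
  · have h2 := card_jetIdx_order_le (N := N) (p := p) (ℓ := ℓ) (by omega)
    simp only [not_le, Nat.lt_succ_iff]
    rw [h2]
    simp

/-- All `p` derivatives are taken in one direction. This makes the momentum products non-empty for
every `ℓ ≤ p`. -/
theorem exists_jetIdx_order_eq (hN : 0 < N) : ∃ m : JetIdx N p, m.order = p :=
  ⟨⟨Pi.single ⟨0, hN⟩ (Fin.last p), by
    rw [Finset.sum_eq_single ⟨0, hN⟩] <;> simp +contextual⟩, by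
    unfold JetIdx.order JetIdx.exps
    rw [Finset.sum_eq_single ⟨0, hN⟩] <;> simp +contextual⟩

end Counting

end DRO

/-! ### The theorem -/

theorem theorem2 {N : ℕ} (hN : 0 < N) (p : ℕ) {ι : Type*} [Fintype ι] [DecidableEq ι] [Nonempty ι]
    (ρ : Matrix (Fin N) (Fin N) ℂ →ₗ[ℂ] Matrix ι ι ℂ)
    (hρ : ∀ A B, ρ (A * B - B * A) = ρ A * ρ B - ρ B * ρ A) (lam w : ℂ) :
    -- the vacuum: lowest energy and reducibility
    (∀ s : DRO.Stat,
      DRO.IsCyclicState s lam w (DRO.vac s : DRO.Fock s N p ι) ∧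
      DRO.HasEnergy s lam w (DRO.vac s : DRO.Fock s N p ι)
        (DRO.lowestEnergy s N p (Fintype.card ι) lam w) ∧
      (∀ A ∈ DRO.droAlg s ρ p lam w, ∀ wA : ℝ, 0 < wA →
        DRO.ham s N p ι lam w * A - A * DRO.ham s N p ι lam w = (-(wA : ℂ)) • A → A (DRO.vac s) = 0) ∧
      (∃ W : Submodule (DRO.droAlg s ρ p lam w) (DRO.Fock s N p ι), W ≠ ⊥ ∧ W ≠ ⊤)) ∧
    -- scalar bosonic zero-jets
    (p = 0 → Fintype.card ι = 1 → ∀ (A : DRO.Comp N p ι) (n : ℕ),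
      DRO.IsCyclicState .boson lam w ((DRO.phiF .boson A 0 ^ n) (DRO.vac .boson)) ∧
      DRO.HasEnergy .boson lam w ((DRO.phiF .boson A 0 ^ n) (DRO.vac .boson))
        (DRO.lowestEnergy .boson N p (Fintype.card ι) lam w + n * w) ∧
      (1 ≤ n → DRO.SeparatedFromVacuum .boson ρ lam w
        ((DRO.phiF .boson A 0 ^ n) (DRO.vac .boson)))) ∧
    -- fermionic `p`-jets, products of all modes of order at most `ℓ`
    (∀ ℓ ≤ p, ∀ o : List (DRO.Comp N p ι), DRO.Enumerates o (fun A => A.2.order ≤ ℓ) → ∀ k : ℕ,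
      DRO.IsCyclicState .fermion lam w (DRO.stack .fermion (DRO.phiProd .fermion o) 0 k) ∧
      DRO.HasEnergy .fermion lam w (DRO.stack .fermion (DRO.phiProd .fermion o) 0 k)
        (DRO.lowestEnergy .fermion N p (Fintype.card ι) lam w +
          1 / 2 * ((N + ℓ).choose ℓ : ℂ) * (Fintype.card ι : ℂ) *
            ((k : ℂ) ^ 2 + (2 * w - 1) * k)) ∧
      (1 ≤ k → DRO.SeparatedFromVacuum .fermion ρ lam w
        (DRO.stack .fermion (DRO.phiProd .fermion o) 0 k))) ∧
    -- fermionic `p`-jets, products of all momenta of order from `ℓ` up to `p`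
    (∀ ℓ ≤ p, ∀ o : List (DRO.Comp N p ι), DRO.Enumerates o (fun A => ℓ ≤ A.2.order) → ∀ k : ℕ,
      DRO.IsCyclicState .fermion lam w (DRO.stack .fermion (DRO.momProd .fermion o) 1 k) ∧
      DRO.HasEnergy .fermion lam w (DRO.stack .fermion (DRO.momProd .fermion o) 1 k)
        (DRO.lowestEnergy .fermion N p (Fintype.card ι) lam w +
          1 / 2 * (((N + p).choose p : ℂ) -
              (if ℓ = 0 then 0 else ((N + ℓ - 1).choose (ℓ - 1) : ℂ))) * (Fintype.card ι : ℂ) *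
            ((k : ℂ) ^ 2 - (2 * w - 1) * k)) ∧
      (1 ≤ k → DRO.SeparatedFromVacuum .fermion ρ lam w
        (DRO.stack .fermion (DRO.momProd .fermion o) 1 k)) ∧
      (1 ≤ k → DRO.stack .fermion (DRO.momProd .fermion o) 0 k = 0)) := by
  refine ⟨fun s => ⟨DRO.isCyclicState_vac s lam w, DRO.hasEnergy_vac s lam w,
      fun A hA r hr h => DRO.apply_vac_eq_zero hA hr h, ?_⟩, fun _ _ A n =>
      ⟨DRO.isCyclicState_phiF_pow_vac A lam w n, DRO.hasEnergy_phiF_pow_vac A lam w n, fun hn =>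
        DRO.separatedFromVacuum (k := n) (by omega) (DRO.phiF_pow_vac_mem_charged A n)
          (DRO.phiF_pow_vac_ne_zero A n)⟩, fun ℓ hℓ o ho k => ?_, fun ℓ hℓ o ho k => ?_⟩
  · obtain ⟨m, -⟩ := DRO.exists_jetIdx_order_eq (p := p) hN
    obtain ⟨i⟩ := (inferInstance : Nonempty ι)
    -- The witness of reducibility, for either statistics, is `φ̂(0)|0⟩`: it has charge `1`, and
    -- `π̂(0)` takes it to a non-zero multiple of the vacuum. Hence the submodule generated by the
    -- vacuum is proper.
    have h0 : DRO.op s (.phi (i, m) 0) (DRO.vac s) ≠ 0 := fun h => by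
      have h1 := DRO.op_op_apply s (.mom (i, m) 0) (.phi (i, m) 0) (DRO.vac s)
      rw [h, DRO.op_vac s (x := .mom (i, m) 0) le_rfl, map_zero, map_zero, smul_zero, zero_add,
        eq_comm, smul_eq_zero] at h1
      refine h1.elim (fun h2 => ?_) (DRO.vac_ne_zero s)
      simp [DRO.pairing] at h2
    have hsep := DRO.separatedFromVacuum (ρ := ρ) (lam := lam) (w := w) (k := 0 + 1) (by omega)
      (DRO.raisesCharge_op (.phi (i, m) 0) 0 _ (DRO.vac_mem_charged s)) h0
    refine ⟨Submodule.span _ {DRO.vac s}, fun h => ?_, fun h => ?_⟩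
    · exact DRO.vac_ne_zero s (Submodule.span_singleton_eq_bot.1 h)
    · exact hsep.2 (h ▸ Submodule.mem_top)
  · have hX := DRO.conjugateModes_phi (N := N) (p := p) (ι := ι)
    have hF : ∀ n, DRO.phiProd .fermion o n =
        (o.map fun A => DRO.op .fermion (.phi A n)).prod := fun n => rfl
    have hlen := ho.length_eq (P := fun m => m.order ≤ ℓ)
    rw [DRO.card_jetIdx_order_le hℓ] at hlen
    have hne : o ≠ [] := by
      rintro rfl
      exact (Nat.mul_pos Fintype.card_pos (Nat.choose_pos (Nat.le_add_left ℓ N))).ne hlen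
    refine ⟨(DRO.filled_stack hX ho.1 hF k).cyclic, (DRO.hasEnergy_stack hX hF k).congr ?_,
      DRO.separatedFromVacuum_stack hX one_ne_zero ho.1 hne hF⟩
    rw [hlen]
    push_cast
    ring
  · have hX := DRO.conjugateModes_mom (N := N) (p := p) (ι := ι)
    have hF : ∀ n, DRO.momProd .fermion o n =
        (o.map fun A => DRO.op .fermion (.mom A n)).prod := fun n => rfl
    have hlen := ho.length_eq (P := fun m => ℓ ≤ m.order)
    have hne : o ≠ [] := by
      rintro rfl
      obtain ⟨m, hm⟩ := DRO.exists_jetIdx_order_eq (p := p) hN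
      obtain ⟨i⟩ := (inferInstance : Nonempty ι)
      exact List.not_mem_nil ((ho.2 (i, m)).2 (hℓ.trans hm.ge))
    refine ⟨(DRO.filled_stack hX ho.1 hF k).cyclic, (DRO.hasEnergy_stack hX hF k).congr ?_,
      DRO.separatedFromVacuum_stack hX (by norm_num) ho.1 hne hF,
      DRO.stack_momProd_zero_eq_zero hne⟩
    rw [← DRO.card_jetIdx_le_order hℓ, hlen]
    push_cast
    ring
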